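/- Let $\mathcal H$ be a complex Hilbert space, $\mathcal A\subseteq\mathscr B(\mathcal H)$ a von Neumann algebra and $\tau:\mathcal A\to\mathcal A$ a normal contractive completely positive map. For a linear map $T$ on a von Neumann algebra put $E_\lambda(T)=\{x: T(x)=\lambda x\}$, let $E(T)$ be the linear span of $\bigcup_{|\lambda|=1}E_\lambda(T)$, let $\mathcal P(T)$ be the norm closure of $E(T)$, and let $\tilde T(x\oplus c)=[T(x)+c(1-T(1))]\oplus c$ be the unitization of $T$. Let $(\mathcal K,\mathcal B,\theta)$ be a minimal dilation of $\tau$: $\mathcal K\supseteq\mathcal H$ is a Hilbert space with orthogonal projection $p$ onto $\mathcal H$ (operators $x$ on $\mathcal H$ are identified with $pxp$ on $\mathcal K$); $\mathcal B\subseteq\mathscr B(\mathcal K)$ is a von Neumann algebra with $\mathcal A=p\mathcal Bp$; $\theta:\mathcal B\to\mathcal B$ is a normal, not necessarily unital, $*$-endomorphism; $\tau^n(x)=p\,\theta^n(x)\,p$ for all $x\in\mathcal A$, $n\ge 0$; the vectors $\theta^n(x_n)\cdots\theta(x_1)h$ ($n\ge0$, $x_i\in\mathcal A$, $h\in\mathcal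 H$) span a dense subspace of $\mathcal K$; $\mathcal B$ is the von Neumann algebra generated by $\{\theta^n(x): n\ge 0,\ x\in\mathcal A\}$; and $\tilde\theta$ on $\mathcal B\oplus\mathbb C$ dilates $\tilde\tau$ on $\mathcal A\oplus\mathbb C$ in the same sense, $\tilde\tau^n(y)=(p\oplus1)\,\tilde\theta^n(y)\,(p\oplus1)$ for all $y\in\mathcal A\oplus\mathbb C$, $n\ge 0$ (this last condition is automatic if $\tau$ is unital). Then: 1. If $|\lambda|=1$ and $x\in E_\lambda(\tau)$, there is a unique $\widehat x\in E_\lambda(\theta)$ with $p\widehat xp=x$, and $\widehat x=\lim_{n\to\infty}\lambda^{-n}\theta^n(x)$ in the strong operator topology. 2. The compression $z\mapsto pzp$ restricts to a bijection of $\mathcal P(\theta)$ onto $\mathcal P(\tau)$ which is a complete isometric isomorphism: for every $k$ and every $k\times k$ matrix $(z_{ij})$ over $\mathcal P(\theta)$, $\|(pz_{ij}p)\|=\|(z_{ij})\|$, and $(pz_{ij}p)\ge0$ if and only if $(z_{ij})\ge 0$. 3. $\mathcal P(\theta)$ is a $C^*$-subalgebra of $\mathcal B$. Writing $\widehat x\in\mathcal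 P(\theta)$ for the element with $p\widehat xp=x$ ($x\in\mathcal P(\tau)$), the product $x\circ y=p\,\widehat x\,\widehat y\,p$ makes $\mathcal P(\tau)$, with the norm and involution of $\mathcal A$, a (possibly non-unital, possibly zero) $C^*$-algebra, and $(pzp)\circ(pwp)=p(zw)p$ for $z,w\in\mathcal P(\theta)$. The product $\circ$ does not depend on the choice of the minimal dilation. The $C^*$-algebra $(\mathcal P(\tau),\circ)$ is the peripheral Poisson boundary of $\tau$. -/

import Mathlib

open Filter Topology

namespace PeripheralBoundary

section CPMaps

variable {H : Type*} [NormedAddCommGroup H] [InnerProductSpace ℂ H] [CompleteSpace H]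
  {A : VonNeumannAlgebra H}

/-- Complete positivity of a linear map `τ : A → A`: applying `τ` entrywise to a positive element
of `M_k(A) ⊆ M_k(B(H))` gives a positive element, for every `k`. -/
def IsCompletelyPositive (τ : A.toStarSubalgebra →ₗ[ℂ] A.toStarSubalgebra) : Prop :=
  ∀ (k : ℕ) (M : Fin k → Fin k → A.toStarSubalgebra),
    0 ≤ CStarMatrix.ofMatrix (fun i j => (M i j : H →L[ℂ] H)) →
    0 ≤ CStarMatrix.ofMatrix (fun i j => (τ (M i j) : H →L[ℂ] H))

/-- The normal (ultraweakly continuous) functionals on `A`: those of the form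
`x ↦ ∑ᵢ ⟪ξᵢ, x ηᵢ⟫` with `∑ᵢ ‖ξᵢ‖² < ∞` and `∑ᵢ ‖ηᵢ‖² < ∞`. -/
def IsNormalFunctional (φ : A.toStarSubalgebra → ℂ) : Prop :=
  ∃ ξ η : ℕ → H, (Summable fun i => ‖ξ i‖ ^ 2) ∧ (Summable fun i => ‖η i‖ ^ 2) ∧
    ∀ x : A.toStarSubalgebra,
      HasSum (fun i => inner ℂ (ξ i) ((x : H →L[ℂ] H) (η i))) (φ x)

/-- A map `τ : A → A` is normal if it is continuous for the ultraweak topology, that is, if it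
pulls back normal functionals to normal functionals. -/
def IsNormalMap (τ : A.toStarSubalgebra → A.toStarSubalgebra) : Prop :=
  ∀ φ : A.toStarSubalgebra → ℂ, IsNormalFunctional φ → IsNormalFunctional fun x => φ (τ x)

/-- The eigenspace `E_μ(T) = {x : T x = μ x}`. -/
noncomputable def eigenspace (T : A.toStarSubalgebra →ₗ[ℂ] A.toStarSubalgebra) (μ : ℂ) :
    Submodule ℂ A.toStarSubalgebra :=
  Module.End.eigenspace T μ

/-- `E(T)`: the linear span of the peripheral eigenvectors of `T` (eigenvalue of modulus one). -/
noncomputable def peripheralSpan (T : A.toStarSubalgebra →ₗ[ℂ] A.toStarSubalgebra) :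
    Submodule ℂ A.toStarSubalgebra :=
  Submodule.span ℂ {x | ∃ μ : ℂ, ‖μ‖ = 1 ∧ x ∈ eigenspace T μ}

/-- `P(T)`: the norm closure of `E(T)`. -/
noncomputable def peripheralSpace (T : A.toStarSubalgebra →ₗ[ℂ] A.toStarSubalgebra) :
    Submodule ℂ A.toStarSubalgebra :=
  (peripheralSpan T).topologicalClosure

/-- The unitization `(x, c) ↦ (T x + c (1 - T 1), c)` of `T`, a linear map on `A ⊕ ℂ`. -/
noncomputable def unitization (T : A.toStarSubalgebra →ₗ[ℂ] A.toStarSubalgebra)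
    (y : A.toStarSubalgebra × ℂ) : A.toStarSubalgebra × ℂ :=
  (T y.1 + y.2 • (1 - T 1), y.2)

end CPMaps

section Dilation

variable {H : Type*} [NormedAddCommGroup H] [InnerProductSpace ℂ H] [CompleteSpace H]
  {K : Type*} [NormedAddCommGroup K] [InnerProductSpace ℂ K] [CompleteSpace K]

/-- The operator on `K` which is `x` on `H` (embedded in `K` by `ι`) and `0` on the orthogonal
complement of `H`. -/
noncomputable def extendOp (ι : H →ₗᵢ[ℂ] K) (x : H →L[ℂ] H) : K →L[ℂ] K :=
  ι.toContinuousLinearMap ∘L x ∘L ContinuousLinearMap.adjoint ι.toContinuousLinearMap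

/-- The compression `z ↦ p z p` of an operator on `K` to `H`, as an operator on `H`; here `p` is
the orthogonal projection of `K` onto the range of `ι`. -/
noncomputable def compressOp (ι : H →ₗᵢ[ℂ] K) (z : K →L[ℂ] K) : H →L[ℂ] H :=
  ContinuousLinearMap.adjoint ι.toContinuousLinearMap ∘L z ∘L ι.toContinuousLinearMap

/-- The vectors `θⁿ(xₙ) θⁿ⁻¹(xₙ₋₁) ⋯ θ(x₁) h`, where `j x` is the copy of `x` in the algebra `B`
on which `θ` acts. -/
noncomputable def dilationWord {A : VonNeumannAlgebra H} {B : VonNeumannAlgebra K} (ι : H →ₗᵢ[ℂ] K)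
    (θ : B.toStarSubalgebra → B.toStarSubalgebra)
    (j : A.toStarSubalgebra → B.toStarSubalgebra) (x : ℕ → A.toStarSubalgebra) (h : H) : ℕ → K
  | 0 => ι h
  | n + 1 => (θ^[n + 1] (j (x (n + 1))) : K →L[ℂ] K) (dilationWord ι θ j x h n)

/-- A minimal dilation `(K, B, θ)` of a contractive completely positive map `τ : A → A`,
`A ⊆ B(H)`. The Hilbert space `H` is regarded as a subspace of `K` through the isometry `ι`, and
`x ∈ A` is identified with the operator `p x p` on `K` (`extendOp ι x`). -/
structure MinimalDilation {A : VonNeumannAlgebra H}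
    (τ : A.toStarSubalgebra →ₗ[ℂ] A.toStarSubalgebra)
    (K : Type*) [NormedAddCommGroup K] [InnerProductSpace ℂ K] [CompleteSpace K] where
  /-- The inclusion of `H` in `K`. -/
  ι : H →ₗᵢ[ℂ] K
  /-- The von Neumann algebra on the dilation space. -/
  B : VonNeumannAlgebra K
  /-- The dilating `*`-endomorphism (not assumed unital). -/
  θ : B.toStarSubalgebra →⋆ₙₐ[ℂ] B.toStarSubalgebra
  normal : IsNormalMap (A := B) θ
  extend_mem : ∀ x ∈ A, extendOp ι x ∈ B.toStarSubalgebra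
  compress_mem : ∀ z ∈ B, compressOp ι z ∈ A.toStarSubalgebra
  /-- `τⁿ(x) = p θⁿ(x) p`. -/
  dilates : ∀ (n : ℕ) (x : A.toStarSubalgebra),
    compressOp ι (θ^[n] ⟨extendOp ι x, extend_mem x x.2⟩ : B.toStarSubalgebra) =
      (τ^[n] x : H →L[ℂ] H)
  /-- The unitization of `θ` on `B ⊕ ℂ` dilates the unitization of `τ` on `A ⊕ ℂ`: the minimal
  dilation of a contractive map is the corresponding part of the minimal dilation of its
  unitization. (The `ℂ`-components agree trivially; for unital `τ` this adds nothing.) -/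
  unitization_dilates : ∀ (n : ℕ) (x : A.toStarSubalgebra) (c : ℂ),
    compressOp ι
        ((unitization (A := B) (θ : B.toStarSubalgebra →ₗ[ℂ] B.toStarSubalgebra))^[n]
          (⟨extendOp ι x, extend_mem x x.2⟩, c)).1 =
      (((unitization τ)^[n] (x, c)).1 : H →L[ℂ] H)
  /-- `K` is the closed linear span of the vectors `θⁿ(xₙ) ⋯ θ(x₁) h`. -/
  span_words : (Submodule.span ℂ {k : K | ∃ (n : ℕ) (x : ℕ → A.toStarSubalgebra) (h : H),
    k = dilationWord ι θ (fun a => ⟨extendOp ι a, extend_mem a a.2⟩) x h n}).topologicalClosure = ⊤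
  /-- `B` is the von Neumann algebra generated by all `θⁿ(x)`. -/
  generates : (B : Set (K →L[ℂ] K)) = Set.centralizer (Set.centralizer
    {z : K →L[ℂ] K | ∃ (n : ℕ) (x : A.toStarSubalgebra),
      z = (θ^[n] ⟨extendOp ι x, extend_mem x x.2⟩ : B.toStarSubalgebra)})

namespace MinimalDilation

variable {A : VonNeumannAlgebra H} {τ : A.toStarSubalgebra →ₗ[ℂ] A.toStarSubalgebra}

/-- `θ` as a linear map. -/
noncomputable def endo (D : MinimalDilation τ K) : D.B.toStarSubalgebra →ₗ[ℂ] D.B.toStarSubalgebra :=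
  (D.θ : D.B.toStarSubalgebra →ₗ[ℂ] D.B.toStarSubalgebra)

/-- The copy of `x ∈ A` in `B`. -/
noncomputable def embed (D : MinimalDilation τ K) (x : A.toStarSubalgebra) :
    D.B.toStarSubalgebra :=
  ⟨extendOp D.ι x, D.extend_mem x x.2⟩

/-- The compression map `z ↦ p z p` from `B` to `A`. -/
noncomputable def compress (D : MinimalDilation τ K) :
    D.B.toStarSubalgebra →ₗ[ℂ] A.toStarSubalgebra where
  toFun z := ⟨compressOp D.ι z, D.compress_mem z z.2⟩
  map_add' z w := by
    apply Subtype.ext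
    ext h
    simp [compressOp]
  map_smul' c z := by
    apply Subtype.ext
    ext h
    simp [compressOp]

open Classical in
/-- The lift of `x`: the element `x̂` of `P(θ)` with `p x̂ p = x` (and `0` if there is none). -/
noncomputable def lift (D : MinimalDilation τ K) (x : A.toStarSubalgebra) :
    D.B.toStarSubalgebra :=
  if h : ∃ z ∈ peripheralSpace D.endo, D.compress z = x then h.choose else 0

/-- The extended Choi–Effros product `x ∘ y = p x̂ ŷ p`. -/
noncomputable def circ (D : MinimalDilation τ K) (x y : A.toStarSubalgebra) :
    A.toStarSubalgebra :=
  D.compress (D.lift x * D.lift y)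

end MinimalDilation

/-- The subspace `S` of `A`, with the norm and involution of `A` and the product `m`, is a
(not necessarily unital) `C*`-algebra. -/
structure IsCStarAlgebraFor {A : VonNeumannAlgebra H} (S : Submodule ℂ A.toStarSubalgebra)
    (m : A.toStarSubalgebra → A.toStarSubalgebra → A.toStarSubalgebra) : Prop where
  complete : IsComplete (S : Set A.toStarSubalgebra)
  star_mem : ∀ x ∈ S, star x ∈ S
  mul_mem : ∀ x ∈ S, ∀ y ∈ S, m x y ∈ S
  add_mul : ∀ x ∈ S, ∀ y ∈ S, ∀ z ∈ S, m (x + y) z = m x z + m y z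
  mul_add : ∀ x ∈ S, ∀ y ∈ S, ∀ z ∈ S, m x (y + z) = m x y + m x z
  smul_mul : ∀ (c : ℂ), ∀ x ∈ S, ∀ y ∈ S, m (c • x) y = c • m x y
  mul_smul : ∀ (c : ℂ), ∀ x ∈ S, ∀ y ∈ S, m x (c • y) = c • m x y
  mul_assoc : ∀ x ∈ S, ∀ y ∈ S, ∀ z ∈ S, m (m x y) z = m x (m y z)
  star_mul : ∀ x ∈ S, ∀ y ∈ S, star (m x y) = m (star y) (star x)
  norm_mul_le : ∀ x ∈ S, ∀ y ∈ S, ‖m x y‖ ≤ ‖x‖ * ‖y‖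
  norm_star_mul_self : ∀ x ∈ S, ‖m (star x) x‖ = ‖x‖ ^ 2

end Dilation

end PeripheralBoundary

/-! Everything rests on the way `p` sits under the iterates of `θ`. The unitization condition gives
`p θ(1 - p) p = 0`, hence `θⁿ(1 - p) p = 0` for all `n`. Two consequences: the compression
intertwines `θ` and `τ` on all of `B`, not only on the copy of `A` (`compress_iter`); and `θᵐ(1 -
p)` kills every word of length at most `m`, so `θⁿ(1 - p) → 0` strongly by minimality.

An eigenvector `w` of `θ` with `|μ| = 1` satisfies `μ⁻ⁿ θⁿ(p w p) = θⁿ(p) w θⁿ(p)`, which therefore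
tends strongly to `w`; this is uniqueness of lifts (`tendsto_rescaled_compress`). Conversely, for `τ
x = μ x` put `yₙ = μ⁻ⁿ θⁿ(x)`. The compression of `|yₙ₊d - yₙ|²` is `τⁿ⁺ᵈ(x* x) - τⁿ(x* x)`, an
increment of a bounded monotone quantity, so `yₙ` is strongly Cauchy on words and then everywhere;
normality of `θ` makes the limit an eigenvector (`exists_lift`).

To treat all eigenvalues at once, take an ultrafilter along which `μⁿ → 1` for every unimodular `μ`.
Along it `θⁿ(p z p) → z` strongly for every `z ∈ P(θ)`. Since the maps `x ↦ θⁿ(x)` are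
`*`-homomorphisms, the inverse of the compression is a point-strong limit of completely contractive,
completely positive maps, whence the complete isometry and order isomorphism. Multiplying two such
limits and compressing gives `x ∘ y = lim τⁿ(x y)`, which mentions no dilation. -/

namespace PeripheralBoundary

/-! ### Norm and positivity of operator matrices. -/

section CStar

open scoped ComplexOrder

/-- An injective `*`-homomorphism of `C*`-algebras reflects positivity. -/
theorem nonneg_of_map_nonneg {A B : Type*} [NonUnitalCStarAlgebra A] [PartialOrder A]
    [StarOrderedRing A] [NonUnitalCStarAlgebra B] [PartialOrder B] [StarOrderedRing B]
    (φ : A →⋆ₙₐ[ℂ] B) (hφ : Function.Injective φ) {a : A} (ha : 0 ≤ φ a) : 0 ≤ a := by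
  have hsa : IsSelfAdjoint a := hφ (by rw [map_star]; exact IsSelfAdjoint.of_nonneg ha)
  have hdec : a⁺ - a⁻ = a := CFC.posPart_sub_negPart a hsa
  have hmono : ∀ b : A, 0 ≤ b → 0 ≤ φ b := fun b hb => map_nonneg φ hb
  -- The decomposition into orthogonal positive parts is unique, so `φ` carries `a⁻` to `(φ a)⁻`,
  -- which vanishes.
  have h1 := CFC.posPart_negPart_unique (a := φ a) (b := φ a⁺) (c := φ a⁻)
    (by rw [← map_sub, hdec]) (by rw [← map_mul, CFC.posPart_mul_negPart, map_zero])
    (hmono _ (CFC.posPart_nonneg a)) (hmono _ (CFC.negPart_nonneg a))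
  have h2 : (φ a)⁻ = 0 := (CFC.negPart_eq_zero_iff _ (IsSelfAdjoint.of_nonneg ha)).2 ha
  have h3 : a⁻ = 0 := hφ (by rw [← h1.2, h2, map_zero])
  rw [← hdec, h3, sub_zero]
  exact CFC.posPart_nonneg a

section MatrixOp

variable {H : Type*} [NormedAddCommGroup H] [InnerProductSpace ℂ H]

/-- The operator on `Hᵏ` given by a `k × k` matrix of operators on `H`. -/
noncomputable def matrixOp {k : ℕ} (M : CStarMatrix (Fin k) (Fin k) (H →L[ℂ] H)) :
    PiLp 2 (fun _ : Fin k => H) →L[ℂ] PiLp 2 (fun _ : Fin k => H) :=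
  (PiLp.continuousLinearEquiv 2 ℂ (fun _ : Fin k => H)).symm.toContinuousLinearMap ∘L
    ContinuousLinearMap.pi (fun i => ∑ j, M i j ∘L PiLp.proj 2 (fun _ : Fin k => H) j)

theorem matrixOp_apply {k : ℕ} (M : CStarMatrix (Fin k) (Fin k) (H →L[ℂ] H))
    (ξ : PiLp 2 (fun _ : Fin k => H)) (i : Fin k) :
    matrixOp M ξ i = ∑ j, M i j (ξ j) := by
  simp [matrixOp]

theorem inner_matrixOp {k : ℕ} (M : CStarMatrix (Fin k) (Fin k) (H →L[ℂ] H))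
    (ξ η : PiLp 2 (fun _ : Fin k => H)) :
    inner ℂ ξ (matrixOp M η) = ∑ i, ∑ j, inner ℂ (ξ i) (M i j (η j)) := by
  simp [PiLp.inner_apply, matrixOp_apply, inner_sum]

theorem tendsto_matrixOp {α : Type*} {l : Filter α} {k : ℕ}
    {M : α → CStarMatrix (Fin k) (Fin k) (H →L[ℂ] H)} {N : CStarMatrix (Fin k) (Fin k) (H →L[ℂ] H)}
    (h : ∀ i j v, Tendsto (fun n => M n i j v) l (𝓝 (N i j v))) (ξ : PiLp 2 (fun _ : Fin k => H)) :
    Tendsto (fun n => matrixOp (M n) ξ) l (𝓝 (matrixOp N ξ)) := by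
  have h1 : Tendsto (fun n i => matrixOp (M n) ξ i) l (𝓝 fun i => matrixOp N ξ i) := by
    refine tendsto_pi_nhds.2 fun i => ?_
    simp only [matrixOp_apply]
    exact tendsto_finsetSum _ fun j _ => h i j (ξ j)
  exact ((PiLp.continuous_toLp 2 (fun _ : Fin k => H)).tendsto _).comp h1

end MatrixOp

variable {H : Type*} [NormedAddCommGroup H] [InnerProductSpace ℂ H] [CompleteSpace H]
  {K : Type*} [NormedAddCommGroup K] [InnerProductSpace ℂ K] [CompleteSpace K]

/-- `matrixOp` as a `*`-homomorphism. -/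
noncomputable def matrixOpHom (k : ℕ) : CStarMatrix (Fin k) (Fin k) (H →L[ℂ] H) →⋆ₙₐ[ℂ]
    (PiLp 2 (fun _ : Fin k => H) →L[ℂ] PiLp 2 (fun _ : Fin k => H)) where
  toFun := matrixOp
  map_smul' c M := by
    ext ξ i
    simp [matrixOp_apply, Finset.smul_sum]
  map_zero' := by
    ext ξ i
    simp [matrixOp_apply]
  map_add' M N := by
    ext ξ i
    simp [matrixOp_apply, Finset.sum_add_distrib]
  map_mul' M N := by
    ext ξ i
    simp only [matrixOp_apply, CStarMatrix.mul_apply, mul_apply_eq_comp, sum_apply,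
      map_sum]
    exact Finset.sum_comm
  map_star' M := by
    refine ContinuousLinearMap.ext fun η => ext_inner_left ℂ fun ξ => ?_
    rw [ContinuousLinearMap.star_eq_adjoint, ContinuousLinearMap.adjoint_inner_right,
      inner_matrixOp, ← inner_conj_symm, inner_matrixOp, map_sum, Finset.sum_comm]
    simp only [map_sum, inner_conj_symm, CStarMatrix.star_apply,
      ContinuousLinearMap.star_eq_adjoint, ContinuousLinearMap.adjoint_inner_right]

theorem matrixOpHom_injective (k : ℕ) :
    Function.Injective (matrixOpHom (H := H) k) := by
  rw [injective_iff_map_eq_zero]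
  intro M hM
  ext i j h
  have := congrArg (fun T => T (WithLp.toLp 2 (Pi.single j h)) i) hM
  simpa [matrixOpHom, matrixOp_apply, Pi.single_apply, apply_ite] using this

theorem norm_matrixOp {k : ℕ} (M : CStarMatrix (Fin k) (Fin k) (H →L[ℂ] H)) :
    ‖matrixOp M‖ = ‖M‖ :=
  NonUnitalStarAlgHom.norm_map (matrixOpHom k) (matrixOpHom_injective k) M

/-- The quadratic form is the description of positivity that survives both compression and strong
limits. -/
theorem cstarMatrix_nonneg_iff {k : ℕ} (M : CStarMatrix (Fin k) (Fin k) (H →L[ℂ] H)) :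
    0 ≤ M ↔ ∀ ξ : PiLp 2 (fun _ : Fin k => H), 0 ≤ inner ℂ ξ (matrixOp M ξ) := by
  have h : 0 ≤ M ↔ 0 ≤ matrixOp M :=
    ⟨fun h => show 0 ≤ matrixOpHom (H := H) k M from map_nonneg (matrixOpHom k) h,
      fun h => nonneg_of_map_nonneg (matrixOpHom k) (matrixOpHom_injective k) h⟩
  rw [h, ContinuousLinearMap.nonneg_iff_isPositive]
  constructor
  · intro h ξ
    exact h.inner_nonneg_right ξ
  · intro h
    rw [ContinuousLinearMap.isPositive_iff_complex]
    intro ξ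
    have h1 := h ξ
    rw [← inner_conj_symm]
    generalize inner ℂ ξ (matrixOp M ξ) = w at h1
    rw [Complex.le_def] at h1
    exact ⟨Complex.ext rfl (by simpa using h1.2.symm), by simpa using h1.1⟩

/-- A bicommutant is norm closed. This makes `A` a C*-algebra, so that `*`-homomorphisms out of it
are automatically contractive. -/
theorem isClosed_toStarSubalgebra (A : VonNeumannAlgebra H) :
    IsClosed (A.toStarSubalgebra : Set (H →L[ℂ] H)) := by
  rw [VonNeumannAlgebra.coe_toStarSubalgebra, ← A.centralizer_centralizer]
  exact Set.isClosed_centralizer _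

/-- A `*`-homomorphism from a von Neumann algebra is completely contractive and completely
positive. -/
theorem norm_map_matrix_le_and_nonneg (A : VonNeumannAlgebra H)
    (ψ : A.toStarSubalgebra →⋆ₙₐ[ℂ] (K →L[ℂ] K)) {k : ℕ}
    (M : Fin k → Fin k → A.toStarSubalgebra) :
    ‖CStarMatrix.ofMatrix (fun i j => ψ (M i j))‖ ≤
        ‖CStarMatrix.ofMatrix (fun i j => (M i j : H →L[ℂ] H))‖ ∧
      (0 ≤ CStarMatrix.ofMatrix (fun i j => (M i j : H →L[ℂ] H)) →
        0 ≤ CStarMatrix.ofMatrix (fun i j => ψ (M i j))) := by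
  have := isClosed_toStarSubalgebra A
  let : PartialOrder A.toStarSubalgebra := CStarAlgebra.spectralOrder _
  have : StarOrderedRing A.toStarSubalgebra := CStarAlgebra.spectralOrderedRing _
  let φ : A.toStarSubalgebra →⋆ₙₐ[ℂ] (H →L[ℂ] H) :=
    (A.toStarSubalgebra.subtype : A.toStarSubalgebra →⋆ₙₐ[ℂ] (H →L[ℂ] H))
  let M' : CStarMatrix (Fin k) (Fin k) A.toStarSubalgebra := CStarMatrix.ofMatrix M
  -- `ψ` is defined on `A` only, while norm and positivity are measured in matrices over `B(H)`.
  -- Injectivity of the inclusion lets both be pulled back to matrices over `A`.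
  have hinj : Function.Injective (CStarMatrix.mapₙₐ (n := Fin k) φ) := by
    intro X Y h
    ext i j : 2
    exact CStarMatrix.ext_iff.2 h i j
  have e1 : CStarMatrix.mapₙₐ φ M' = CStarMatrix.ofMatrix (fun i j => (M i j : H →L[ℂ] H)) := rfl
  have e2 : CStarMatrix.mapₙₐ ψ M' = CStarMatrix.ofMatrix (fun i j => ψ (M i j)) := rfl
  rw [← e1, ← e2, NonUnitalStarAlgHom.norm_map _ hinj]
  exact ⟨NonUnitalStarAlgHom.norm_apply_le _ _,
    fun h => map_nonneg _ (nonneg_of_map_nonneg _ hinj h)⟩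

end CStar

/-! ### Limits on closed spans, and simultaneous recurrence of rotations. -/

section Limits

/-- Uniformly bounded linear maps that converge to a bounded linear map on a set converge to it on
the closed span of the set. -/
theorem tendsto_of_mem_closure_span {α E F : Type*} [NormedAddCommGroup E] [NormedSpace ℂ E]
    [NormedAddCommGroup F] [NormedSpace ℂ F] {l : Filter α} {T : α → E →ₗ[ℂ] F} {S : E →ₗ[ℂ] F}
    {C : ℝ} (hT : ∀ i x, ‖T i x‖ ≤ C * ‖x‖) (hS : ∀ x, ‖S x‖ ≤ C * ‖x‖) {s : Set E}
    (h : ∀ x ∈ s, Tendsto (fun i => T i x) l (𝓝 (S x))) {x : E}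
    (hx : x ∈ (Submodule.span ℂ s).topologicalClosure) :
    Tendsto (fun i => T i x) l (𝓝 (S x)) := by
  have hspan : ∀ y ∈ Submodule.span ℂ s, Tendsto (fun i => T i y) l (𝓝 (S y)) := by
    intro y hy
    induction hy using Submodule.span_induction with
    | mem y hy => exact h y hy
    | zero => simpa using tendsto_const_nhds
    | add y z _ _ hy hz => simpa using hy.add hz
    | smul c y _ hy => simpa using hy.const_smul c
  rw [Metric.tendsto_nhds]
  intro ε hε
  -- `C` may be zero or negative, so `|C| + 1` serves as a positive divisor.
  have hC : 0 < |C| + 1 := by positivity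
  obtain ⟨y, hy, hxy⟩ := Metric.mem_closure_iff.1 (show x ∈ closure _ from hx)
    (ε / (3 * (|C| + 1))) (by positivity)
  have hb : ∀ R : E →ₗ[ℂ] F, (∀ x, ‖R x‖ ≤ C * ‖x‖) → dist (R x) (R y) < ε / 3 := by
    intro R hR
    rw [dist_eq_norm, ← map_sub]
    rw [dist_eq_norm] at hxy
    calc ‖R (x - y)‖ ≤ C * ‖x - y‖ := hR _
      _ ≤ (|C| + 1) * ‖x - y‖ := by
        gcongr
        linarith [le_abs_self C]
      _ < (|C| + 1) * (ε / (3 * (|C| + 1))) := by gcongr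
      _ = ε / 3 := by field_simp
  filter_upwards [Metric.tendsto_nhds.1 (hspan y hy) (ε / 3) (by positivity)] with i hi
  have h1 := hb (T i) (hT i)
  have h2 := hb S hS
  have h3 := dist_triangle4 (T i x) (T i y) (S y) (S x)
  rw [dist_comm (S y)] at h3
  linarith

/-- There is an ultrafilter on `ℕ` along which the powers of every unimodular number tend to `1`. -/
theorem exists_ultrafilter_tendsto_pow_one :
    ∃ U : Ultrafilter ℕ, (U : Filter ℕ) ≤ atTop ∧
      ∀ μ : ℂ, ‖μ‖ = 1 → Tendsto (fun n : ℕ => μ ^ n) U (𝓝 1) := by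
  -- Recurrence in the compact group of all functions `Circle → Circle`: the powers of the identity
  -- function cluster at `1`, and an ultrafilter realizing this works for all `μ` at once.
  obtain ⟨U, hU, h⟩ := mapClusterPt_iff_ultrafilter.1
    (mapClusterPt_one_atTop_pow (fun z : Circle => z))
  refine ⟨U, hU, fun μ hμ => ?_⟩
  have h1 := tendsto_pi_nhds.1 h ⟨μ, by simpa [Submonoid.unitSphere] using hμ⟩
  have h2 := ((continuous_subtype_val (p := (· ∈ Submonoid.unitSphere ℂ))).tendsto _).comp h1
  exact h2

end Limits

end PeripheralBoundary

namespace PeripheralBoundary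

/-! ### The projection `p`, its iterates under `θ`, and the intertwining relation. -/

section Dilation

variable {H : Type*} [NormedAddCommGroup H] [InnerProductSpace ℂ H] [CompleteSpace H]
  {K : Type*} [NormedAddCommGroup K] [InnerProductSpace ℂ K] [CompleteSpace K]

theorem adjoint_apply_self (ι : H →ₗᵢ[ℂ] K) (h : H) :
    ContinuousLinearMap.adjoint ι.toContinuousLinearMap (ι h) = h :=
  congrArg (fun T : H →L[ℂ] H => T h) ι.adjoint_comp_self

theorem norm_adjoint_apply_le (ι : H →ₗᵢ[ℂ] K) (k : K) :
    ‖ContinuousLinearMap.adjoint ι.toContinuousLinearMap k‖ ≤ ‖k‖ := by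
  refine ((ContinuousLinearMap.adjoint ι.toContinuousLinearMap).le_opNorm k).trans ?_
  rw [LinearIsometryEquiv.norm_map]
  exact mul_le_of_le_one_left (norm_nonneg k) ι.norm_toContinuousLinearMap_le

namespace MinimalDilation

variable {A : VonNeumannAlgebra H} {τ : A.toStarSubalgebra →ₗ[ℂ] A.toStarSubalgebra}
  (D : MinimalDilation τ K)

theorem embed_apply (x : A.toStarSubalgebra) (k : K) :
    (D.embed x : K →L[ℂ] K) k =
      D.ι ((x : H →L[ℂ] H) (ContinuousLinearMap.adjoint D.ι.toContinuousLinearMap k)) :=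
  rfl

theorem compress_apply (z : D.B.toStarSubalgebra) (h : H) :
    (D.compress z : H →L[ℂ] H) h =
      ContinuousLinearMap.adjoint D.ι.toContinuousLinearMap ((z : K →L[ℂ] K) (D.ι h)) :=
  rfl

theorem inner_compress (z : D.B.toStarSubalgebra) (h h' : H) :
    inner ℂ h ((D.compress z : H →L[ℂ] H) h') = inner ℂ (D.ι h) ((z : K →L[ℂ] K) (D.ι h')) := by
  rw [compress_apply, ContinuousLinearMap.adjoint_inner_right]
  rfl

/-- The embedding of `A` in `B` as a (non-unital) `*`-homomorphism. -/
noncomputable def embedHom : A.toStarSubalgebra →⋆ₙₐ[ℂ] D.B.toStarSubalgebra where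
  toFun := D.embed
  map_smul' c x := by
    ext k
    simp [embed_apply]
  map_zero' := by
    ext k
    simp [embed_apply]
  map_add' x y := by
    ext k
    simp [embed_apply]
  map_mul' x y := by
    ext k
    simp [embed_apply, adjoint_apply_self]
  map_star' x := by
    apply Subtype.ext
    refine ContinuousLinearMap.ext fun η => ext_inner_left ℂ fun ξ => ?_
    simp only [StarMemClass.coe_star, ContinuousLinearMap.star_eq_adjoint,
      ContinuousLinearMap.adjoint_inner_right]
    rw [embed_apply, embed_apply, StarMemClass.coe_star, ContinuousLinearMap.star_eq_adjoint,
      ← LinearIsometry.coe_toContinuousLinearMap, ← ContinuousLinearMap.adjoint_inner_left,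
      ContinuousLinearMap.adjoint_inner_right, ContinuousLinearMap.adjoint_inner_right]

theorem embedHom_apply (x : A.toStarSubalgebra) : D.embedHom x = D.embed x := rfl

/-- The powers of `θ`. -/
noncomputable def iter (n : ℕ) : D.B.toStarSubalgebra →⋆ₙₐ[ℂ] D.B.toStarSubalgebra := D.θ ^ n

theorem coe_iter (n : ℕ) : ⇑(D.iter n) = D.endo^[n] :=
  hom_coe_pow DFunLike.coe rfl (fun _ _ => rfl) D.θ n

theorem iter_apply (n : ℕ) (z : D.B.toStarSubalgebra) : D.iter n z = D.endo^[n] z :=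
  congrFun (D.coe_iter n) z

theorem iter_zero (z : D.B.toStarSubalgebra) : D.iter 0 z = z := by
  simp [iter_apply]

theorem iter_add (m n : ℕ) (z : D.B.toStarSubalgebra) :
    D.iter (m + n) z = D.iter m (D.iter n z) := by
  simp only [iter_apply, Function.iterate_add_apply]

theorem iter_one (z : D.B.toStarSubalgebra) : D.iter 1 z = D.endo z := by
  simp [iter_apply]

theorem norm_iter_le (n : ℕ) (z : D.B.toStarSubalgebra) : ‖D.iter n z‖ ≤ ‖z‖ :=
  have := isClosed_toStarSubalgebra D.B
  NonUnitalStarAlgHom.norm_apply_le (D.iter n) z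

/-- The projection `p` of `K` onto `H`. -/
noncomputable def proj : D.B.toStarSubalgebra := D.embed 1

theorem proj_apply_ι (h : H) : (D.proj : K →L[ℂ] K) (D.ι h) = D.ι h := by
  simp [proj, embed_apply, adjoint_apply_self]

theorem star_proj : star D.proj = D.proj := by
  rw [proj, ← embedHom_apply, ← map_star, star_one]

theorem proj_mul_proj : D.proj * D.proj = D.proj := by
  rw [proj, ← embedHom_apply, ← map_mul, one_mul]

theorem proj_mul_embed (x : A.toStarSubalgebra) : D.proj * D.embed x = D.embed x := by
  rw [proj, ← embedHom_apply, ← embedHom_apply, ← map_mul, one_mul]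

theorem embed_compress (z : D.B.toStarSubalgebra) :
    D.embed (D.compress z) = D.proj * z * D.proj := by
  ext k
  simp [proj, embed_apply, compress_apply]

theorem compress_embed (x : A.toStarSubalgebra) : D.compress (D.embed x) = x := by
  ext h
  simp [compress_apply, embed_apply, adjoint_apply_self]

theorem compress_mul_embed (z : D.B.toStarSubalgebra) (x : A.toStarSubalgebra) :
    D.compress (z * D.embed x) = D.compress z * x := by
  ext h
  simp [compress_apply, embed_apply, adjoint_apply_self]

theorem compress_star (z : D.B.toStarSubalgebra) : D.compress (star z) = star (D.compress z) := by
  apply Subtype.ext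
  refine ContinuousLinearMap.ext fun η => ext_inner_left ℂ fun ξ => ?_
  rw [inner_compress, StarMemClass.coe_star, StarMemClass.coe_star,
    ContinuousLinearMap.star_eq_adjoint, ContinuousLinearMap.star_eq_adjoint,
    ContinuousLinearMap.adjoint_inner_right, ContinuousLinearMap.adjoint_inner_right,
    ← inner_conj_symm, ← D.inner_compress, inner_conj_symm]

theorem norm_embed_le (x : A.toStarSubalgebra) : ‖D.embed x‖ ≤ ‖x‖ :=
  have := isClosed_toStarSubalgebra A
  have := isClosed_toStarSubalgebra D.B
  NonUnitalStarAlgHom.norm_apply_le D.embedHom x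

theorem norm_compress_le (z : D.B.toStarSubalgebra) : ‖D.compress z‖ ≤ ‖z‖ := by
  refine ContinuousLinearMap.opNorm_le_bound _ (norm_nonneg z) fun h => ?_
  change ‖(D.compress z : H →L[ℂ] H) h‖ ≤ _
  rw [compress_apply]
  refine (norm_adjoint_apply_le _ _).trans ?_
  simpa using (z : K →L[ℂ] K).le_opNorm (D.ι h)

theorem compress_iter_embed (n : ℕ) (x : A.toStarSubalgebra) :
    D.compress (D.iter n (D.embed x)) = τ^[n] x := by
  rw [iter_apply]
  exact Subtype.ext (D.dilates n x)

/-- The unitization condition at `n = 1`, `(x, c) = (0, 1)` says `p θ(1) p = τ(1)`, and `p θ(p) p =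
τ(1)` too. -/
theorem compress_endo_one_sub_proj : D.compress (D.endo (1 - D.proj)) = 0 := by
  have h1 : D.compress (D.endo D.proj) = τ 1 := by
    simpa [iter_apply, proj] using D.compress_iter_embed 1 1
  have h2 := D.unitization_dilates 1 0 1
  have h3 : D.compress (D.endo (D.embed 0) + (1 : ℂ) • (1 - D.endo 1)) =
      τ 0 + (1 : ℂ) • (1 - τ 1) := Subtype.ext h2
  have h4 : D.embed 0 = 0 := map_zero D.embedHom
  have h5 : D.compress 1 = 1 := by
    ext h
    simp [compress_apply, adjoint_apply_self]
  rw [h4, map_zero, map_zero, one_smul, one_smul, zero_add, zero_add, map_sub, h5] at h3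
  rw [map_sub, map_sub, h1, sub_eq_zero]
  exact sub_right_injective h3

theorem iter_mul_iter (n : ℕ) (z w : D.B.toStarSubalgebra) :
    D.iter n (z * w) = D.iter n z * D.iter n w := map_mul _ _ _

theorem one_sub_proj_mul_proj : (1 - D.proj) * D.proj = 0 := by
  rw [sub_mul, one_mul, proj_mul_proj, sub_self]

theorem mul_proj_eq_zero_of_apply {z : D.B.toStarSubalgebra}
    (hz : ∀ h, (z : K →L[ℂ] K) (D.ι h) = 0) : z * D.proj = 0 := by
  ext k
  simp [proj, embed_apply, hz]

theorem mul_proj_eq_zero_of_compress {z : D.B.toStarSubalgebra}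
    (hz : D.compress (star z * z) = 0) : z * D.proj = 0 := by
  refine D.mul_proj_eq_zero_of_apply fun h => ?_
  have h1 := D.inner_compress (star z * z) h h
  rw [hz] at h1
  rw [← inner_self_eq_zero (𝕜 := ℂ)]
  simpa [ContinuousLinearMap.star_eq_adjoint, ContinuousLinearMap.adjoint_inner_right] using h1.symm

/-- `θ(1 - p)` is a projection `q`, so `p q p = 0` is the vanishing of `|q p|²`. -/
theorem endo_one_sub_proj_mul_proj : D.endo (1 - D.proj) * D.proj = 0 := by
  apply D.mul_proj_eq_zero_of_compress
  rw [← iter_one, ← map_star, ← map_mul, star_sub, star_one, star_proj, mul_sub, mul_one,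
    one_sub_proj_mul_proj, sub_zero, iter_one, compress_endo_one_sub_proj]

/-- The projections `θⁿ(1 - p)` are orthogonal to `p`. -/
theorem iter_one_sub_proj_mul_proj (n : ℕ) : D.iter n (1 - D.proj) * D.proj = 0 := by
  induction n with
  | zero => rw [iter_zero, one_sub_proj_mul_proj]
  | succ n ih =>
    -- `θ` need not be unital: a factor `θ(1)` is inserted by multiplicativity and, standing next to
    -- `p`, replaced by `θ(p)`; the induction hypothesis then applies inside `θ`.
    have h1 : D.iter 1 1 * D.proj = D.iter 1 D.proj * D.proj := by
      rw [← sub_eq_zero, ← sub_mul, ← map_sub, iter_one, endo_one_sub_proj_mul_proj]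
    rw [add_comm, iter_add, ← mul_one (D.iter n _), iter_mul_iter, mul_assoc, h1, ← mul_assoc,
      ← iter_mul_iter, ih, map_zero, zero_mul]

theorem iter_mul_proj (n : ℕ) (z : D.B.toStarSubalgebra) :
    D.iter n z * D.proj = D.iter n (z * D.proj) * D.proj := by
  rw [← sub_eq_zero, ← sub_mul, ← map_sub, show z - z * D.proj = z * (1 - D.proj) by
    rw [mul_sub, mul_one], iter_mul_iter, mul_assoc, iter_one_sub_proj_mul_proj, mul_zero]

theorem proj_mul_iter (n : ℕ) (z : D.B.toStarSubalgebra) :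
    D.proj * D.iter n z = D.proj * D.iter n (D.proj * z) := by
  apply star_injective
  rw [star_mul, star_mul, ← map_star, ← map_star, star_proj, star_mul, star_proj]
  exact D.iter_mul_proj n _

theorem compress_eq_of_proj {z w : D.B.toStarSubalgebra}
    (h : D.proj * z * D.proj = D.proj * w * D.proj) : D.compress z = D.compress w := by
  rw [← D.compress_embed (D.compress z), embed_compress, h, ← embed_compress, compress_embed]

/-- As `θⁿ(1 - p)` is orthogonal to `p`, the operator `p θⁿ(z) p` depends on `z` only through `p z
p`. -/
theorem compress_iter (n : ℕ) (z : D.B.toStarSubalgebra) :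
    D.compress (D.iter n z) = τ^[n] (D.compress z) := by
  rw [← D.compress_iter_embed, embed_compress]
  apply D.compress_eq_of_proj
  rw [proj_mul_iter, mul_assoc, iter_mul_proj, ← mul_assoc]

theorem compress_endo (z : D.B.toStarSubalgebra) : D.compress (D.endo z) = τ (D.compress z) := by
  simpa [iter_apply] using D.compress_iter 1 z

theorem map_star_of_dilation (D : MinimalDilation τ K) (x : A.toStarSubalgebra) : τ (star x) = star (τ x) := by
  rw [← D.compress_embed x, ← compress_star, ← compress_endo, ← compress_endo, ← compress_star,
    ← iter_one, ← iter_one, map_star]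

theorem iter_one_sub_proj_word (xs : ℕ → A.toStarSubalgebra) (h : H) (n m : ℕ) (hnm : n ≤ m) :
    (D.iter m (1 - D.proj) : K →L[ℂ] K) (dilationWord D.ι D.θ D.embed xs h n) = 0 := by
  cases n with
  | zero =>
    have := congrArg (fun z : D.B.toStarSubalgebra => (z : K →L[ℂ] K) (D.ι h))
      (D.iter_one_sub_proj_mul_proj m)
    simpa [proj_apply_ι, dilationWord] using this
  | succ n =>
    obtain ⟨d, rfl⟩ := Nat.exists_eq_add_of_le hnm
    -- With `x = p x`, the product is `θⁿ⁺¹` of `θᵈ(1 - p) p x = 0`.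
    have h1 : D.iter (n + 1 + d) (1 - D.proj) * D.iter (n + 1) (D.embed (xs (n + 1))) = 0 := by
      rw [iter_add, ← iter_mul_iter, ← proj_mul_embed, ← mul_assoc, iter_one_sub_proj_mul_proj,
        zero_mul, map_zero]
    have := congrArg (fun z : D.B.toStarSubalgebra => (z : K →L[ℂ] K)
      (dilationWord D.ι D.θ D.embed xs h n)) h1
    rw [D.iter_apply (n + 1)] at this
    exact this

/-- Uniformly bounded operators converge strongly as soon as they converge on the words. -/
theorem tendsto_of_words {α : Type*} {l : Filter α} {T : α → K →L[ℂ] K} {S : K →L[ℂ] K} {C : ℝ}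
    (hT : ∀ i, ‖T i‖ ≤ C) (hS : ‖S‖ ≤ C)
    (h : ∀ (n : ℕ) (xs : ℕ → A.toStarSubalgebra) (h : H),
      Tendsto (fun i => T i (dilationWord D.ι D.θ D.embed xs h n)) l
        (𝓝 (S (dilationWord D.ι D.θ D.embed xs h n)))) (k : K) :
    Tendsto (fun i => T i k) l (𝓝 (S k)) := by
  refine tendsto_of_mem_closure_span (T := fun i => (T i).toLinearMap) (S := S.toLinearMap) (C := C)
    (fun i x => (T i).le_of_opNorm_le (hT i) x) (fun x => S.le_of_opNorm_le hS x)
    ?_ (D.span_words ▸ Submodule.mem_top (x := k))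
  rintro _ ⟨n, xs, h', rfl⟩
  exact h n xs h'

theorem tendsto_iter_one_sub_proj (k : K) :
    Tendsto (fun n => (D.iter n (1 - D.proj) : K →L[ℂ] K) k) atTop (𝓝 0) := by
  refine D.tendsto_of_words (S := 0) (C := ‖1 - D.proj‖) (fun n => D.norm_iter_le n _)
    (by simp) (fun n xs h => ?_) k
  refine tendsto_const_nhds.congr' ?_
  filter_upwards [eventually_ge_atTop n] with m hm
  exact (D.iter_one_sub_proj_word xs h n m hm).symm

end MinimalDilation

end Dilation

/-! ### Lifting peripheral eigenvectors. -/

section Dilation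

theorem iterate_apply_of_eigenvector {M : Type*} [AddCommGroup M] [Module ℂ M] {f : M →ₗ[ℂ] M}
    {μ : ℂ} {x : M} (hx : f x = μ • x) (n : ℕ) : f^[n] x = μ ^ n • x := by
  induction n with
  | zero => simp
  | succ n ih => rw [Function.iterate_succ_apply', ih, map_smul, hx, smul_smul, pow_succ]

variable {H : Type*} [NormedAddCommGroup H] [InnerProductSpace ℂ H] [CompleteSpace H]
  {K : Type*} [NormedAddCommGroup K] [InnerProductSpace ℂ K] [CompleteSpace K]

theorem mem_eigenspace {A : VonNeumannAlgebra H} {T : A.toStarSubalgebra →ₗ[ℂ] A.toStarSubalgebra}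
    {μ : ℂ} {x : A.toStarSubalgebra} : x ∈ eigenspace T μ ↔ T x = μ • x :=
  Module.End.mem_eigenspace_iff

/-- A strong limit of elements of a von Neumann algebra belongs to it. -/
theorem mem_of_tendsto_strong (B : VonNeumannAlgebra K) {α : Type*} {l : Filter α} [l.NeBot]
    {y : α → K →L[ℂ] K} (hy : ∀ i, y i ∈ B) {z : K →L[ℂ] K}
    (h : ∀ k, Tendsto (fun i => y i k) l (𝓝 (z k))) : z ∈ B := by
  rw [← SetLike.mem_coe, ← B.centralizer_centralizer, Set.mem_centralizer_iff]
  intro m hm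
  ext k
  have h1 : Tendsto (fun i => m (y i k)) l (𝓝 (m (z k))) := (m.continuous.tendsto _).comp (h k)
  refine tendsto_nhds_unique h1 ((h (m k)).congr fun i => ?_)
  exact congrArg (fun T : K →L[ℂ] K => T k) (Set.mem_centralizer_iff.1 hm (y i) (hy i))

theorem isNormalFunctional_inner (B : VonNeumannAlgebra K) (ξ η : K) :
    IsNormalFunctional (A := B) fun x => inner ℂ ξ ((x : K →L[ℂ] K) η) := by
  refine ⟨fun i => if i = 0 then ξ else 0, fun i => if i = 0 then η else 0, ?_, ?_, fun x => ?_⟩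
  · exact summable_of_ne_finset_zero (s := {0}) fun i hi => by simp_all
  · exact summable_of_ne_finset_zero (s := {0}) fun i hi => by simp_all
  · have h := hasSum_single (f := fun i : ℕ => inner ℂ (if i = 0 then ξ else 0)
      ((x : K →L[ℂ] K) (if i = 0 then η else 0))) 0 fun i hi => by simp [hi]
    simpa using h

/-- A normal functional is continuous along bounded strongly convergent sequences. -/
theorem IsNormalFunctional.tendsto {B : VonNeumannAlgebra K} {φ : B.toStarSubalgebra → ℂ}
    (hφ : IsNormalFunctional φ) {y : ℕ → B.toStarSubalgebra} {z : B.toStarSubalgebra} {C : ℝ}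
    (hy : ∀ n, ‖y n‖ ≤ C)
    (h : ∀ k, Tendsto (fun n => (y n : K →L[ℂ] K) k) atTop (𝓝 ((z : K →L[ℂ] K) k))) :
    Tendsto (fun n => φ (y n)) atTop (𝓝 (φ z)) := by
  obtain ⟨ξ, η, hξ, hη, hs⟩ := hφ
  have hC : 0 ≤ C := (norm_nonneg _).trans (hy 0)
  simp_rw [fun x => (hs x).tsum_eq.symm]
  refine tendsto_tsum_of_dominated_convergence ((hξ.add hη).mul_left C)
    (fun i => tendsto_const_nhds.inner (h (η i))) (Eventually.of_forall fun n i => ?_)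
  have h1 : ‖(y n : K →L[ℂ] K) (η i)‖ ≤ C * ‖η i‖ :=
    (y n : K →L[ℂ] K).le_of_opNorm_le (hy n) _
  calc _ ≤ ‖ξ i‖ * ‖(y n : K →L[ℂ] K) (η i)‖ := norm_inner_le_norm _ _
    _ ≤ ‖ξ i‖ * (C * ‖η i‖) := by gcongr
    _ ≤ C * (‖ξ i‖ ^ 2 + ‖η i‖ ^ 2) := by
      nlinarith [mul_nonneg hC (sq_nonneg (‖ξ i‖ - ‖η i‖)),
        mul_nonneg hC (add_nonneg (sq_nonneg ‖ξ i‖) (sq_nonneg ‖η i‖))]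

theorem norm_sq_apply {B : VonNeumannAlgebra K} (z : B.toStarSubalgebra) (w : K) :
    ‖(z : K →L[ℂ] K) w‖ ^ 2 =
      (inner ℂ w (((star z * z : B.toStarSubalgebra) : K →L[ℂ] K) w)).re := by
  rw [← inner_self_eq_norm_sq (𝕜 := ℂ)]
  simp [ContinuousLinearMap.star_eq_adjoint, ContinuousLinearMap.adjoint_inner_right]

namespace MinimalDilation

variable {A : VonNeumannAlgebra H} {τ : A.toStarSubalgebra →ₗ[ℂ] A.toStarSubalgebra}
  (D : MinimalDilation τ K)

theorem iter_of_mem_eigenspace {μ : ℂ} {w : D.B.toStarSubalgebra} (hw : w ∈ eigenspace D.endo μ)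
    (n : ℕ) : D.iter n w = μ ^ n • w := by
  rw [iter_apply, iterate_apply_of_eigenvector (mem_eigenspace.1 hw)]

/-- The rescaled iterates `μ⁻ⁿ θⁿ(x)`. -/
noncomputable def rescaled (μ : ℂ) (x : A.toStarSubalgebra) (n : ℕ) : D.B.toStarSubalgebra :=
  (μ ^ n)⁻¹ • D.iter n (D.embed x)

variable {μ : ℂ} {x : A.toStarSubalgebra}

theorem norm_rescaled_le (hμ : ‖μ‖ = 1) (n : ℕ) : ‖D.rescaled μ x n‖ ≤ ‖x‖ := by
  rw [rescaled, norm_smul, norm_inv, norm_pow, hμ, one_pow, inv_one, one_mul]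
  exact (D.norm_iter_le n _).trans (D.norm_embed_le x)

/-- Peripheral eigenvectors of `θ` are recovered from their compressions. -/
theorem tendsto_rescaled_compress (hμ : ‖μ‖ = 1) {w : D.B.toStarSubalgebra}
    (hw : w ∈ eigenspace D.endo μ) (k : K) :
    Tendsto (fun n => (D.rescaled μ (D.compress w) n : K →L[ℂ] K) k) atTop
      (𝓝 ((w : K →L[ℂ] K) k)) := by
  have hμ0 : μ ≠ 0 := norm_ne_zero_iff.1 (by rw [hμ]; exact one_ne_zero)
  -- An eigenvector with nonzero eigenvalue lies in the range of `θⁿ`, on which `θⁿ(1)` acts as a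
  -- unit.
  have h1 : ∀ n, D.iter n 1 * w = w := fun n => by
    have := congrArg (fun z => (μ ^ n)⁻¹ • z) (D.iter_mul_iter n 1 w)
    simp only [one_mul, D.iter_of_mem_eigenspace hw, mul_smul_comm, smul_smul,
      inv_mul_cancel₀ (pow_ne_zero n hμ0), one_smul] at this
    exact this.symm
  have h2 : ∀ n, w * D.iter n 1 = w := fun n => by
    have := congrArg (fun z => (μ ^ n)⁻¹ • z) (D.iter_mul_iter n w 1)
    simp only [mul_one, D.iter_of_mem_eigenspace hw, smul_mul_assoc, smul_smul,
      inv_mul_cancel₀ (pow_ne_zero n hμ0), one_smul] at this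
    exact this.symm
  have h3 : ∀ n, D.rescaled μ (D.compress w) n = w - w * D.iter n (1 - D.proj) -
      D.iter n (1 - D.proj) * w + D.iter n (1 - D.proj) * (w * D.iter n (1 - D.proj)) := fun n => by
    have h4 : D.iter n D.proj = D.iter n 1 - D.iter n (1 - D.proj) := by
      rw [← map_sub, sub_sub_cancel]
    rw [rescaled, embed_compress, iter_mul_iter, iter_mul_iter, D.iter_of_mem_eigenspace hw,
      mul_smul_comm, smul_mul_assoc, smul_smul, inv_mul_cancel₀ (pow_ne_zero n hμ0), one_smul, h4,
      sub_mul, h1, mul_sub, sub_mul, h2, sub_mul, mul_assoc, h2, mul_assoc]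
    abel
  have hQ := D.tendsto_iter_one_sub_proj
  have t1 : Tendsto (fun n => (w : K →L[ℂ] K) ((D.iter n (1 - D.proj) : K →L[ℂ] K) k)) atTop
      (𝓝 0) := by
    have := ((w : K →L[ℂ] K).continuous.tendsto 0).comp (hQ k)
    rwa [map_zero] at this
  have t2 : Tendsto (fun n => (D.iter n (1 - D.proj) : K →L[ℂ] K)
      ((w : K →L[ℂ] K) ((D.iter n (1 - D.proj) : K →L[ℂ] K) k))) atTop (𝓝 0) := by
    have := (tendsto_zero_iff_norm_tendsto_zero.1 t1).const_mul ‖1 - D.proj‖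
    rw [mul_zero] at this
    refine squeeze_zero_norm (fun n => ?_) this
    exact (D.iter n (1 - D.proj) : K →L[ℂ] K).le_of_opNorm_le (D.norm_iter_le n _) _
  have t3 := (((tendsto_const_nhds (x := (w : K →L[ℂ] K) k)).sub t1).sub
    (hQ ((w : K →L[ℂ] K) k))).add t2
  simp only [sub_zero, add_zero] at t3
  refine t3.congr fun n => ?_
  rw [h3]
  simp

theorem rescaled_add (l n : ℕ) :
    D.rescaled μ x (l + n) = (μ ^ l)⁻¹ • D.iter l (D.rescaled μ x n) := by
  rw [rescaled, rescaled, iter_add, map_smul, smul_smul, pow_add, mul_inv]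

/-- Pull `θⁿ` out of the product and compress: what remains is `τⁿ((τᵈ x)* x)`, whose phase cancels
the rescaling. The value is independent of `d`. -/
theorem compress_star_rescaled_mul (hμ : ‖μ‖ = 1) (hx : τ x = μ • x) (n d : ℕ) :
    D.compress (star (D.rescaled μ x (n + d)) * D.rescaled μ x n) = τ^[n] (star x * x) := by
  have hμ0 : μ ≠ 0 := norm_ne_zero_iff.1 (by rw [hμ]; exact one_ne_zero)
  have hstar : star μ = μ⁻¹ := (RCLike.inv_eq_conj hμ).symm
  rw [rescaled, rescaled, iter_add, star_smul, smul_mul_smul_comm, ← map_star, ← iter_mul_iter,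
    map_smul, compress_iter, compress_mul_embed, compress_star, D.compress_iter_embed,
    iterate_apply_of_eigenvector hx, star_smul, smul_mul_assoc,
    ← Module.End.coe_pow, map_smul, smul_smul]
  convert one_smul ℂ _ using 2
  rw [star_inv₀, star_pow, star_pow, hstar, pow_add, inv_pow, inv_pow]
  field_simp

/-- A Pythagoras identity: both cross terms equal the smaller diagonal term. -/
theorem compress_star_mul_rescaled_sub (hμ : ‖μ‖ = 1) (hx : τ x = μ • x) (n d : ℕ) :
    D.compress (star (D.rescaled μ x (n + d) - D.rescaled μ x n) *
      (D.rescaled μ x (n + d) - D.rescaled μ x n)) =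
      τ^[n + d] (star x * x) - τ^[n] (star x * x) := by
  have h1 := D.compress_star_rescaled_mul hμ hx n d
  have h2 := D.compress_star_rescaled_mul hμ hx n 0
  have h3 := D.compress_star_rescaled_mul hμ hx (n + d) 0
  rw [add_zero] at h2 h3
  have h4 : D.compress (star (D.rescaled μ x n) * D.rescaled μ x (n + d)) =
      τ^[n] (star x * x) := by
    have h5 := D.compress_star (star (D.rescaled μ x (n + d)) * D.rescaled μ x n)
    rw [star_mul, star_star, h1, ← h2, ← compress_star, star_mul, star_star, h2] at h5
    exact h5
  rw [star_sub, sub_mul, mul_sub, mul_sub, map_sub, map_sub, map_sub, h1, h2, h3, h4, sub_self,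
    sub_zero]

/-- The numbers `⟪w, θˡ(a* τⁿ(x* x) a) w⟫`. -/
noncomputable def energy (x a : A.toStarSubalgebra) (l : ℕ) (w : K) (n : ℕ) : ℝ :=
  (inner ℂ w ((D.iter l (D.embed (star a * τ^[n] (star x * x) * a)) : K →L[ℂ] K) w)).re

theorem norm_sq_rescaled_sub (hμ : ‖μ‖ = 1) (hx : τ x = μ • x) (a : A.toStarSubalgebra) (l : ℕ)
    (w : K) (n d : ℕ) :
    ‖((D.rescaled μ x (l + (n + d)) - D.rescaled μ x (l + n) : D.B.toStarSubalgebra) : K →L[ℂ] K)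
      ((D.iter l (D.embed a) : K →L[ℂ] K) w)‖ ^ 2 =
      D.energy x a l w (n + d) - D.energy x a l w n := by
  set Z := D.rescaled μ x (n + d) - D.rescaled μ x n
  have h1 : D.rescaled μ x (l + (n + d)) - D.rescaled μ x (l + n) = (μ ^ l)⁻¹ • D.iter l Z := by
    rw [rescaled_add D l (n + d), rescaled_add D l n, ← smul_sub, ← map_sub]
  have h2 : ‖((D.rescaled μ x (l + (n + d)) - D.rescaled μ x (l + n) : D.B.toStarSubalgebra) :
      K →L[ℂ] K) ((D.iter l (D.embed a) : K →L[ℂ] K) w)‖ =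
      ‖(D.iter l (Z * D.embed a) : K →L[ℂ] K) w‖ := by
    rw [h1, iter_mul_iter]
    simp [norm_smul, hμ]
  -- Writing `a = p a` puts `Z* Z` between two copies of `p`, where the Pythagoras identity computes
  -- it.
  have h3 : star (Z * D.embed a) * (Z * D.embed a) =
      D.embed (star a * τ^[n + d] (star x * x) * a) - D.embed (star a * τ^[n] (star x * x) * a) := by
    calc star (Z * D.embed a) * (Z * D.embed a)
        = D.embed (star a) * (D.proj * (star Z * Z) * D.proj) * D.embed a := by
          conv_lhs => rw [← D.proj_mul_embed a]
          simp only [star_mul, star_proj, ← embedHom_apply, map_star, mul_assoc]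
      _ = D.embed (star a * (τ^[n + d] (star x * x) - τ^[n] (star x * x)) * a) := by
          rw [← embed_compress, compress_star_mul_rescaled_sub D hμ hx]
          simp only [← embedHom_apply, map_mul]
      _ = _ := by
          rw [mul_sub, sub_mul]
          simp only [← embedHom_apply, map_sub]
  rw [h2, norm_sq_apply, ← map_star, ← iter_mul_iter, h3, map_sub]
  simp [energy]

theorem tendsto_energy (hμ : ‖μ‖ = 1) (hx : τ x = μ • x) (a : A.toStarSubalgebra) (l : ℕ)
    (w : K) : ∃ L, Tendsto (D.energy x a l w) atTop (𝓝 L) := by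
  -- Each increment is the square of a norm.
  have hmono : Monotone (D.energy x a l w) := by
    intro n m hnm
    obtain ⟨d, rfl⟩ := Nat.exists_eq_add_of_le hnm
    rw [← sub_nonneg, ← D.norm_sq_rescaled_sub hμ hx]
    positivity
  refine ⟨_, tendsto_atTop_ciSup hmono
    ⟨‖w‖ * ((‖star a‖ * ‖star x * x‖ * ‖a‖) * ‖w‖), ?_⟩⟩
  rintro _ ⟨n, rfl⟩
  refine (Complex.re_le_norm _).trans ((norm_inner_le_norm _ _).trans ?_)
  refine mul_le_mul_of_nonneg_left (ContinuousLinearMap.le_of_opNorm_le _ ?_ _) (norm_nonneg _)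
  refine (D.norm_iter_le l _).trans ((D.norm_embed_le _).trans ?_)
  refine (norm_mul_le _ _).trans ?_
  gcongr
  refine (norm_mul_le _ _).trans ?_
  gcongr
  rw [← D.compress_iter_embed]
  exact (D.norm_compress_le _).trans ((D.norm_iter_le n _).trans (D.norm_embed_le _))

theorem tendsto_rescaled_sub (hμ : ‖μ‖ = 1) (hx : τ x = μ • x) (a : A.toStarSubalgebra) (l : ℕ)
    (w : K) :
    Tendsto (fun p : ℕ × ℕ => ((D.rescaled μ x p.1 - D.rescaled μ x p.2 : D.B.toStarSubalgebra) :
      K →L[ℂ] K) ((D.iter l (D.embed a) : K →L[ℂ] K) w)) atTop (𝓝 0) := by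
  obtain ⟨L, hL⟩ := D.tendsto_energy hμ hx a l w
  -- The energy at `n` controls the rescaled iterate of index `l + n`, whence the shift; truncated
  -- subtraction is harmless once both indices are at least `l`.
  have h1 : Tendsto (fun n => D.energy x a l w (n - l)) atTop (𝓝 L) :=
    hL.comp (tendsto_sub_atTop_nat l)
  have h2 : Tendsto (fun p : ℕ × ℕ => √|D.energy x a l w (p.1 - l) - D.energy x a l w (p.2 - l)|)
      atTop (𝓝 0) := by
    rw [← prod_atTop_atTop_eq]
    simpa using ((h1.comp tendsto_fst).sub (h1.comp tendsto_snd)).abs.sqrt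
  have key : ∀ n d, ‖((D.rescaled μ x (l + (n + d)) - D.rescaled μ x (l + n) :
      D.B.toStarSubalgebra) : K →L[ℂ] K) ((D.iter l (D.embed a) : K →L[ℂ] K) w)‖ =
      √|D.energy x a l w (n + d) - D.energy x a l w n| := fun n d => by
    rw [← D.norm_sq_rescaled_sub hμ hx, abs_of_nonneg (by positivity),
      Real.sqrt_sq (norm_nonneg _)]
  rw [tendsto_zero_iff_norm_tendsto_zero]
  refine h2.congr' ?_
  filter_upwards [eventually_ge_atTop (l, l)] with p hp
  obtain ⟨m, hm⟩ := Nat.exists_eq_add_of_le hp.1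
  obtain ⟨n, hn⟩ := Nat.exists_eq_add_of_le hp.2
  dsimp only at hm hn
  rw [hm, hn, Nat.add_sub_cancel_left, Nat.add_sub_cancel_left]
  rcases le_total n m with h | h
  · obtain ⟨d, rfl⟩ := Nat.exists_eq_add_of_le h
    exact (key n d).symm
  · obtain ⟨d, rfl⟩ := Nat.exists_eq_add_of_le h
    rw [abs_sub_comm, ← key m d, ← norm_neg]
    simp

theorem cauchySeq_rescaled (hμ : ‖μ‖ = 1) (hx : τ x = μ • x) (k : K) :
    CauchySeq fun n => (D.rescaled μ x n : K →L[ℂ] K) k := by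
  rw [cauchySeq_iff_tendsto_dist_atTop_0]
  have h := D.tendsto_of_words (l := atTop) (S := 0) (C := ‖x‖ + ‖x‖)
    (T := fun p : ℕ × ℕ => ((D.rescaled μ x p.1 - D.rescaled μ x p.2 : D.B.toStarSubalgebra) :
      K →L[ℂ] K))
    (fun p => (norm_sub_le _ _).trans
      (add_le_add (D.norm_rescaled_le hμ p.1) (D.norm_rescaled_le hμ p.2)))
    (by simp) (fun n xs h => ?_) k
  · simpa [dist_eq_norm] using tendsto_zero_iff_norm_tendsto_zero.1 h
  -- A word of positive length begins with an outer factor `θⁿ⁺¹(xₙ₊₁)`, so `l = n + 1`, `a = xₙ₊₁`.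
  -- The empty word is `h = p h`, so `l = 0`, `a = 1`.
  · cases n with
    | zero =>
      have := D.tendsto_rescaled_sub hμ hx 1 0 (D.ι h)
      rw [iter_zero, ← proj, proj_apply_ι] at this
      exact this
    | succ n =>
      have := D.tendsto_rescaled_sub hμ hx (xs (n + 1)) (n + 1)
        (dilationWord D.ι D.θ D.embed xs h n)
      rw [iter_apply] at this
      exact this

theorem compress_eq_of_tendsto {α : Type*} {l : Filter α} [l.NeBot]
    {y : α → D.B.toStarSubalgebra} {z : D.B.toStarSubalgebra} {x : A.toStarSubalgebra}
    (h : ∀ k, Tendsto (fun i => (y i : K →L[ℂ] K) k) l (𝓝 ((z : K →L[ℂ] K) k)))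
    (hy : ∀ i, D.compress (y i) = x) : D.compress z = x := by
  ext h'
  have h1 := ((ContinuousLinearMap.adjoint D.ι.toContinuousLinearMap).continuous.tendsto _).comp
    (h (D.ι h'))
  refine tendsto_nhds_unique h1 (tendsto_const_nhds.congr fun i => ?_)
  rw [← hy i]
  rfl

/-- Every peripheral eigenvector of `τ` lifts to a peripheral eigenvector of `θ`. -/
theorem exists_lift (hμ : ‖μ‖ = 1) (hx : x ∈ eigenspace τ μ) :
    ∃ z ∈ eigenspace D.endo μ, D.compress z = x ∧
      ∀ k, Tendsto (fun n => (D.rescaled μ x n : K →L[ℂ] K) k) atTop (𝓝 ((z : K →L[ℂ] K) k)) := by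
  rw [mem_eigenspace] at hx
  have hμ0 : μ ≠ 0 := norm_ne_zero_iff.1 (by rw [hμ]; exact one_ne_zero)
  choose f hf using fun k => cauchySeq_tendsto_of_complete (D.cauchySeq_rescaled hμ hx k)
  let S : K →L[ℂ] K := continuousLinearMapOfTendsto
    (fun n => (D.rescaled μ x n : K →L[ℂ] K)) (tendsto_pi_nhds.2 hf)
  have hS : ∀ k, Tendsto (fun n => (D.rescaled μ x n : K →L[ℂ] K) k) atTop (𝓝 (S k)) := hf
  let z : D.B.toStarSubalgebra := ⟨S, mem_of_tendsto_strong D.B (fun n => (D.rescaled μ x n).2) hS⟩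
  have hz : ∀ k, Tendsto (fun n => (D.rescaled μ x n : K →L[ℂ] K) k) atTop
      (𝓝 ((z : K →L[ℂ] K) k)) := hS
  refine ⟨z, ?_, ?_, hz⟩
  · rw [mem_eigenspace]
    ext η
    refine ext_inner_left ℂ fun ξ => ?_
    -- Normality moves `θ` past the bounded strong limit, tested weakly; and `θ(yₙ) = μ yₙ₊₁` for
    -- the rescaled iterates.
    have h1 := (D.normal _ (isNormalFunctional_inner D.B ξ η)).tendsto
      (D.norm_rescaled_le hμ) hz
    have h2 : Tendsto (fun n => inner ℂ ξ (μ • (D.rescaled μ x (n + 1) : K →L[ℂ] K) η)) atTop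
        (𝓝 (inner ℂ ξ (μ • (z : K →L[ℂ] K) η))) :=
      tendsto_const_nhds.inner (((tendsto_add_atTop_iff_nat 1).2 (hz η)).const_smul μ)
    refine tendsto_nhds_unique h1 (h2.congr fun n => ?_)
    rw [add_comm, rescaled_add, iter_one, pow_one]
    simp only [SetLike.val_smul, smul_apply, smul_smul, mul_inv_cancel₀ hμ0, one_smul]
    rfl
  · refine D.compress_eq_of_tendsto hz fun n => ?_
    rw [rescaled, map_smul, D.compress_iter_embed, iterate_apply_of_eigenvector hx, smul_smul,
      inv_mul_cancel₀ (pow_ne_zero n hμ0), one_smul]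

end MinimalDilation

end Dilation

/-! ### The peripheral space: complete isometry, C*-structure, independence of the dilation. -/

section Dilation

open scoped ComplexOrder

variable {H : Type*} [NormedAddCommGroup H] [InnerProductSpace ℂ H] [CompleteSpace H]
  {K : Type*} [NormedAddCommGroup K] [InnerProductSpace ℂ K] [CompleteSpace K]

/-- For multiplicative `T`, eigenvalues multiply and stay on the unit circle; bilinearity and
continuity do the rest. -/
theorem mul_mem_peripheralSpace {B : VonNeumannAlgebra K}
    {T : B.toStarSubalgebra →ₗ[ℂ] B.toStarSubalgebra} (hT : ∀ z w, T (z * w) = T z * T w)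
    {z w : B.toStarSubalgebra} (hz : z ∈ peripheralSpace T) (hw : w ∈ peripheralSpace T) :
    z * w ∈ peripheralSpace T := by
  refine map_mem_closure₂ continuous_mul hz hw fun a ha b hb => ?_
  refine Submodule.span_induction₂ (p := fun a b _ _ => a * b ∈ peripheralSpan T)
    ?_ ?_ ?_ ?_ ?_ ?_ ?_ ha hb
  · rintro a b ⟨μ, hμ, ha⟩ ⟨ν, hν, hb⟩
    refine Submodule.subset_span ⟨μ * ν, by rw [norm_mul, hμ, hν, one_mul], ?_⟩
    rw [mem_eigenspace] at *
    rw [hT, ha, hb, smul_mul_smul_comm]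
  · intro b _
    simp
  · intro a _
    simp
  · intro a b c _ _ _ h1 h2
    rw [add_mul]
    exact Submodule.add_mem _ h1 h2
  · intro a b c _ _ _ h1 h2
    rw [mul_add]
    exact Submodule.add_mem _ h1 h2
  · intro c a b _ _ h
    rw [smul_mul_assoc]
    exact Submodule.smul_mem _ _ h
  · intro c a b _ _ h
    rw [mul_smul_comm]
    exact Submodule.smul_mem _ _ h

theorem star_mem_peripheralSpace {B : VonNeumannAlgebra K}
    {T : B.toStarSubalgebra →ₗ[ℂ] B.toStarSubalgebra} (hT : ∀ z, T (star z) = star (T z))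
    {z : B.toStarSubalgebra} (hz : z ∈ peripheralSpace T) : star z ∈ peripheralSpace T := by
  refine map_mem_closure continuous_star hz fun a ha => ?_
  change a ∈ peripheralSpan T at ha
  change star a ∈ peripheralSpan T
  induction ha using Submodule.span_induction with
  | mem a h =>
    obtain ⟨μ, hμ, ha⟩ := h
    refine Submodule.subset_span ⟨star μ, by rw [norm_star, hμ], ?_⟩
    rw [mem_eigenspace] at *
    rw [hT, ha, star_smul]
  | zero => simp
  | add a b _ _ h1 h2 =>
    rw [star_add]
    exact Submodule.add_mem _ h1 h2
  | smul c a _ h =>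
    rw [star_smul]
    exact Submodule.smul_mem _ _ h

theorem isComplete_peripheralSpace {B : VonNeumannAlgebra K}
    (T : B.toStarSubalgebra →ₗ[ℂ] B.toStarSubalgebra) :
    IsComplete (peripheralSpace T : Set B.toStarSubalgebra) :=
  have : CompleteSpace B.toStarSubalgebra := (isClosed_toStarSubalgebra B).completeSpace_coe
  (Submodule.isClosed_topologicalClosure _).isComplete

namespace MinimalDilation

variable {A : VonNeumannAlgebra H} {τ : A.toStarSubalgebra →ₗ[ℂ] A.toStarSubalgebra}
  (D : MinimalDilation τ K)

/-- Along an ultrafilter for which `μⁿ → 1` for all unimodular `μ`, the operators `θⁿ(p z p)`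
converge strongly to `z`, for every `z ∈ P(θ)`. -/
theorem tendsto_iter_embed_compress {U : Ultrafilter ℕ} (hU : (U : Filter ℕ) ≤ atTop)
    (hpow : ∀ μ : ℂ, ‖μ‖ = 1 → Tendsto (fun n : ℕ => μ ^ n) U (𝓝 1))
    {z : D.B.toStarSubalgebra} (hz : z ∈ peripheralSpace D.endo) (k : K) :
    Tendsto (fun n => (D.iter n (D.embed (D.compress z)) : K →L[ℂ] K) k) U
      (𝓝 ((z : K →L[ℂ] K) k)) := by
  let ev : D.B.toStarSubalgebra →ₗ[ℂ] K :=
    { toFun := fun w => (w : K →L[ℂ] K) k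
      map_add' := fun _ _ => rfl
      map_smul' := fun _ _ => rfl }
  have hev : ∀ w, ‖ev w‖ ≤ ‖k‖ * ‖w‖ := fun w => by
    rw [mul_comm]
    exact (w : K →L[ℂ] K).le_opNorm k
  refine tendsto_of_mem_closure_span (l := (U : Filter ℕ)) (S := ev) (C := ‖k‖)
    (T := fun n => ev ∘ₗ (D.iter n : D.B.toStarSubalgebra →ₗ[ℂ] D.B.toStarSubalgebra) ∘ₗ
      (D.embedHom : A.toStarSubalgebra →ₗ[ℂ] D.B.toStarSubalgebra) ∘ₗ D.compress)
    (fun n w => (hev _).trans ?_) hev ?_ hz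
  · exact mul_le_mul_of_nonneg_left
      ((D.norm_iter_le n _).trans ((D.norm_embed_le _).trans (D.norm_compress_le w)))
      (norm_nonneg k)
  · rintro w ⟨μ, hμ, hw⟩
    have hμ0 : μ ≠ 0 := norm_ne_zero_iff.1 (by rw [hμ]; exact one_ne_zero)
    have h1 := (hpow μ hμ).smul ((D.tendsto_rescaled_compress hμ hw k).mono_left hU)
    rw [one_smul] at h1
    refine h1.congr fun n => ?_
    rw [rescaled]
    simp only [SetLike.val_smul, smul_apply, smul_smul, mul_inv_cancel₀ (pow_ne_zero n hμ0),
      one_smul]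
    rfl

/-- `z` is a strong limit of images of its compression under contractions, and strong limits do not
increase norm bounds. -/
theorem norm_compress {z : D.B.toStarSubalgebra} (hz : z ∈ peripheralSpace D.endo) :
    ‖D.compress z‖ = ‖z‖ := by
  refine le_antisymm (D.norm_compress_le z) ?_
  obtain ⟨U, hU, hpow⟩ := exists_ultrafilter_tendsto_pow_one
  refine ContinuousLinearMap.opNorm_le_bound _ (norm_nonneg _) fun k => ?_
  refine le_of_tendsto (D.tendsto_iter_embed_compress hU hpow hz k).norm
    (Eventually.of_forall fun n => ?_)
  exact ContinuousLinearMap.le_of_opNorm_le _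
    ((D.norm_iter_le n _).trans (D.norm_embed_le _)) k

theorem compress_injOn : Set.InjOn D.compress (peripheralSpace D.endo) := by
  intro z hz w hw h
  rw [← sub_eq_zero, ← norm_eq_zero, ← D.norm_compress (Submodule.sub_mem _ hz hw), map_sub,
    sub_eq_zero.2 h, norm_zero]

theorem continuous_compress : Continuous D.compress :=
  AddMonoidHomClass.continuous_of_bound D.compress 1 fun z => by
    simpa using D.norm_compress_le z

theorem compress_mem_eigenspace {μ : ℂ} {w : D.B.toStarSubalgebra}
    (hw : w ∈ eigenspace D.endo μ) : D.compress w ∈ eigenspace τ μ := by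
  rw [mem_eigenspace] at *
  rw [← compress_endo, hw, map_smul]

theorem compress_mem_peripheralSpace {z : D.B.toStarSubalgebra}
    (hz : z ∈ peripheralSpace D.endo) : D.compress z ∈ peripheralSpace τ := by
  refine map_mem_closure D.continuous_compress hz fun a ha => ?_
  change a ∈ peripheralSpan D.endo at ha
  change a ∈ (peripheralSpan τ).comap D.compress
  refine Submodule.span_le.2 ?_ ha
  rintro w ⟨μ, hμ, hw⟩
  exact Submodule.subset_span ⟨μ, hμ, D.compress_mem_eigenspace hw⟩

/-- The image is an isometric copy of a complete space, hence closed, and it contains every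
peripheral eigenvector of `τ`. -/
theorem compress_surjOn : Set.SurjOn D.compress (peripheralSpace D.endo) (peripheralSpace τ) := by
  have hiso : Isometry ((D.compress : D.B.toStarSubalgebra → A.toStarSubalgebra) ∘
      (Subtype.val : peripheralSpace D.endo → D.B.toStarSubalgebra)) :=
    Isometry.of_dist_eq fun z w => by
      rw [Function.comp_apply, Function.comp_apply, dist_eq_norm, ← map_sub,
        D.norm_compress (Submodule.sub_mem _ z.2 w.2), Subtype.dist_eq, dist_eq_norm]
  have : CompleteSpace (peripheralSpace D.endo) :=
    (isComplete_peripheralSpace D.endo).completeSpace_coe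
  have hclosed : IsClosed (((peripheralSpace D.endo).map D.compress : Submodule ℂ _) :
      Set A.toStarSubalgebra) := by
    have hrange := hiso.isClosedEmbedding.isClosed_range
    rwa [Set.range_comp, Subtype.range_val] at hrange
  intro x hx
  have h := Submodule.topologicalClosure_minimal (peripheralSpan τ)
    (t := (peripheralSpace D.endo).map D.compress) ?_ hclosed hx
  · exact h
  · refine Submodule.span_le.2 ?_
    rintro x ⟨μ, hμ, hx⟩
    obtain ⟨z, hz, hzx, -⟩ := D.exists_lift hμ hx
    exact ⟨z, Submodule.le_topologicalClosure _ (Submodule.subset_span ⟨μ, hμ, hz⟩), hzx⟩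

theorem compress_bijOn :
    Set.BijOn D.compress (peripheralSpace D.endo) (peripheralSpace τ) :=
  ⟨fun _ hz => D.compress_mem_peripheralSpace hz, D.compress_injOn, D.compress_surjOn⟩

theorem matrixOp_compress {k : ℕ} (Z : Fin k → Fin k → D.B.toStarSubalgebra)
    (ξ : PiLp 2 (fun _ : Fin k => H)) (i : Fin k) :
    matrixOp (CStarMatrix.ofMatrix fun i j => (D.compress (Z i j) : H →L[ℂ] H)) ξ i =
      ContinuousLinearMap.adjoint D.ι.toContinuousLinearMap
        (matrixOp (CStarMatrix.ofMatrix fun i j => (Z i j : K →L[ℂ] K))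
          (WithLp.toLp 2 fun j => D.ι (ξ j)) i) := by
  simp only [matrixOp_apply, map_sum]
  rfl

theorem norm_compress_matrix_le {k : ℕ} (Z : Fin k → Fin k → D.B.toStarSubalgebra) :
    ‖CStarMatrix.ofMatrix (fun i j => (D.compress (Z i j) : H →L[ℂ] H))‖ ≤
      ‖CStarMatrix.ofMatrix (fun i j => (Z i j : K →L[ℂ] K))‖ := by
  rw [← norm_matrixOp, ← norm_matrixOp]
  refine ContinuousLinearMap.opNorm_le_bound _ (norm_nonneg _) fun ξ => ?_
  have h1 : ‖(WithLp.toLp 2 fun j => D.ι (ξ j) : PiLp 2 (fun _ : Fin k => K))‖ = ‖ξ‖ := by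
    rw [← sq_eq_sq₀ (norm_nonneg _) (norm_nonneg _), PiLp.norm_sq_eq_of_L2, PiLp.norm_sq_eq_of_L2]
    simp
  rw [← h1]
  refine le_trans ?_ (ContinuousLinearMap.le_opNorm _ _)
  rw [← sq_le_sq₀ (norm_nonneg _) (norm_nonneg _), PiLp.norm_sq_eq_of_L2, PiLp.norm_sq_eq_of_L2]
  gcongr with i
  rw [matrixOp_compress]
  exact norm_adjoint_apply_le _ _

theorem compress_matrix_nonneg {k : ℕ} {Z : Fin k → Fin k → D.B.toStarSubalgebra}
    (hZ : 0 ≤ CStarMatrix.ofMatrix (fun i j => (Z i j : K →L[ℂ] K))) :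
    0 ≤ CStarMatrix.ofMatrix (fun i j => (D.compress (Z i j) : H →L[ℂ] H)) := by
  rw [cstarMatrix_nonneg_iff] at hZ ⊢
  intro ξ
  convert hZ (WithLp.toLp 2 fun j => D.ι (ξ j)) using 1
  rw [inner_matrixOp, inner_matrixOp]
  exact Finset.sum_congr rfl fun i _ => Finset.sum_congr rfl fun j _ => D.inner_compress _ _ _

/-- The compression is completely isometric and a complete order isomorphism on `P(θ)`. -/
theorem compress_matrix {k : ℕ} {Z : Fin k → Fin k → D.B.toStarSubalgebra}
    (hZ : ∀ i j, Z i j ∈ peripheralSpace D.endo) :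
    ‖CStarMatrix.ofMatrix (fun i j => (D.compress (Z i j) : H →L[ℂ] H))‖ =
        ‖CStarMatrix.ofMatrix (fun i j => (Z i j : K →L[ℂ] K))‖ ∧
      (0 ≤ CStarMatrix.ofMatrix (fun i j => (D.compress (Z i j) : H →L[ℂ] H)) ↔
        0 ≤ CStarMatrix.ofMatrix (fun i j => (Z i j : K →L[ℂ] K))) := by
  obtain ⟨U, hU, hpow⟩ := exists_ultrafilter_tendsto_pow_one
  let ψ : ℕ → A.toStarSubalgebra →⋆ₙₐ[ℂ] (K →L[ℂ] K) := fun n =>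
    (D.B.toStarSubalgebra.subtype : D.B.toStarSubalgebra →⋆ₙₐ[ℂ] (K →L[ℂ] K)).comp
      ((D.iter n).comp D.embedHom)
  have hψ := fun n => norm_map_matrix_le_and_nonneg A (ψ n) fun i j => D.compress (Z i j)
  have hlim := tendsto_matrixOp (l := (U : Filter ℕ))
    (M := fun n => CStarMatrix.ofMatrix fun i j => ψ n (D.compress (Z i j)))
    (N := CStarMatrix.ofMatrix fun i j => (Z i j : K →L[ℂ] K))
    fun i j v => D.tendsto_iter_embed_compress hU hpow (hZ i j) v
  refine ⟨le_antisymm (D.norm_compress_matrix_le Z) ?_, fun h => ?_, D.compress_matrix_nonneg⟩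
  · rw [← norm_matrixOp (CStarMatrix.ofMatrix fun i j => (Z i j : K →L[ℂ] K))]
    refine ContinuousLinearMap.opNorm_le_bound _ (norm_nonneg _) fun ξ => ?_
    refine le_of_tendsto (hlim ξ).norm (Eventually.of_forall fun n => ?_)
    refine ContinuousLinearMap.le_of_opNorm_le _ ?_ ξ
    rw [norm_matrixOp]
    exact (hψ n).1
  · rw [cstarMatrix_nonneg_iff]
    intro ξ
    refine ge_of_tendsto' (tendsto_const_nhds.inner (hlim ξ)) fun n => ?_
    exact (cstarMatrix_nonneg_iff _).1 ((hψ n).2 h) ξ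

theorem lift_spec {x : A.toStarSubalgebra} (hx : x ∈ peripheralSpace τ) :
    D.lift x ∈ peripheralSpace D.endo ∧ D.compress (D.lift x) = x := by
  have h : ∃ z ∈ peripheralSpace D.endo, D.compress z = x := D.compress_surjOn hx
  rw [lift, dif_pos h]
  exact h.choose_spec

theorem lift_compress {z : D.B.toStarSubalgebra} (hz : z ∈ peripheralSpace D.endo) :
    D.lift (D.compress z) = z :=
  have h := D.lift_spec (D.compress_mem_peripheralSpace hz)
  D.compress_injOn h.1 hz h.2

theorem circ_compress {z w : D.B.toStarSubalgebra} (hz : z ∈ peripheralSpace D.endo)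
    (hw : w ∈ peripheralSpace D.endo) :
    D.circ (D.compress z) (D.compress w) = D.compress (z * w) := by
  rw [circ, lift_compress D hz, lift_compress D hw]

theorem endo_mul (z w : D.B.toStarSubalgebra) : D.endo (z * w) = D.endo z * D.endo w :=
  map_mul D.θ z w

theorem endo_star (z : D.B.toStarSubalgebra) : D.endo (star z) = star (D.endo z) :=
  map_star D.θ z

theorem isCStarAlgebraFor_endo :
    IsCStarAlgebraFor (peripheralSpace D.endo) (fun z w => z * w) where
  complete := isComplete_peripheralSpace _
  star_mem _ := star_mem_peripheralSpace D.endo_star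
  mul_mem _ hx _ hy := mul_mem_peripheralSpace D.endo_mul hx hy
  add_mul _ _ _ _ _ _ := add_mul _ _ _
  mul_add _ _ _ _ _ _ := mul_add _ _ _
  smul_mul _ _ _ _ _ := smul_mul_assoc _ _ _
  mul_smul _ _ _ _ _ := mul_smul_comm _ _ _
  mul_assoc _ _ _ _ _ _ := mul_assoc _ _ _
  star_mul _ _ _ _ := star_mul _ _
  norm_mul_le _ _ _ _ := norm_mul_le _ _
  norm_star_mul_self _ _ := by rw [CStarRing.norm_star_mul_self, sq]

/-- Transport of structure: the compression is a linear, isometric, `*`-preserving bijection from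
`P(θ)` that carries the product to `∘`. -/
theorem isCStarAlgebraFor_circ : IsCStarAlgebraFor (peripheralSpace τ) D.circ := by
  have hmul : ∀ {z w}, z ∈ peripheralSpace D.endo → w ∈ peripheralSpace D.endo →
      z * w ∈ peripheralSpace D.endo := fun hz hw => mul_mem_peripheralSpace D.endo_mul hz hw
  have hstar : ∀ {z}, z ∈ peripheralSpace D.endo → star z ∈ peripheralSpace D.endo :=
    fun hz => star_mem_peripheralSpace D.endo_star hz
  have hsurj : ∀ x ∈ peripheralSpace τ, ∃ z ∈ peripheralSpace D.endo, D.compress z = x :=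
    fun x hx => D.compress_surjOn hx
  refine ⟨isComplete_peripheralSpace _, ?_, ?_, ?_, ?_, ?_, ?_, ?_, ?_, ?_, ?_⟩
  · exact fun x hx => star_mem_peripheralSpace D.map_star_of_dilation hx
  · intro x hx y hy
    obtain ⟨z, hz, rfl⟩ := hsurj x hx
    obtain ⟨w, hw, rfl⟩ := hsurj y hy
    rw [D.circ_compress hz hw]
    exact D.compress_mem_peripheralSpace (hmul hz hw)
  · intro x hx y hy t ht
    obtain ⟨z, hz, rfl⟩ := hsurj x hx
    obtain ⟨w, hw, rfl⟩ := hsurj y hy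
    obtain ⟨v, hv, rfl⟩ := hsurj t ht
    rw [← map_add, D.circ_compress (Submodule.add_mem _ hz hw) hv, D.circ_compress hz hv,
      D.circ_compress hw hv, ← map_add, add_mul]
  · intro x hx y hy t ht
    obtain ⟨z, hz, rfl⟩ := hsurj x hx
    obtain ⟨w, hw, rfl⟩ := hsurj y hy
    obtain ⟨v, hv, rfl⟩ := hsurj t ht
    rw [← map_add, D.circ_compress hz (Submodule.add_mem _ hw hv), D.circ_compress hz hw,
      D.circ_compress hz hv, ← map_add, mul_add]
  · intro c x hx y hy
    obtain ⟨z, hz, rfl⟩ := hsurj x hx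
    obtain ⟨w, hw, rfl⟩ := hsurj y hy
    rw [← map_smul, D.circ_compress (Submodule.smul_mem _ c hz) hw, D.circ_compress hz hw,
      ← map_smul, smul_mul_assoc]
  · intro c x hx y hy
    obtain ⟨z, hz, rfl⟩ := hsurj x hx
    obtain ⟨w, hw, rfl⟩ := hsurj y hy
    rw [← map_smul, D.circ_compress hz (Submodule.smul_mem _ c hw), D.circ_compress hz hw,
      ← map_smul, mul_smul_comm]
  · intro x hx y hy t ht
    obtain ⟨z, hz, rfl⟩ := hsurj x hx
    obtain ⟨w, hw, rfl⟩ := hsurj y hy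
    obtain ⟨v, hv, rfl⟩ := hsurj t ht
    rw [D.circ_compress hz hw, D.circ_compress (hmul hz hw) hv, D.circ_compress hw hv,
      D.circ_compress hz (hmul hw hv), mul_assoc]
  · intro x hx y hy
    obtain ⟨z, hz, rfl⟩ := hsurj x hx
    obtain ⟨w, hw, rfl⟩ := hsurj y hy
    rw [D.circ_compress hz hw, ← compress_star, ← compress_star, ← compress_star,
      D.circ_compress (hstar hw) (hstar hz), star_mul]
  · intro x hx y hy
    obtain ⟨z, hz, rfl⟩ := hsurj x hx
    obtain ⟨w, hw, rfl⟩ := hsurj y hy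
    rw [D.circ_compress hz hw, D.norm_compress (hmul hz hw), D.norm_compress hz,
      D.norm_compress hw]
    exact norm_mul_le _ _
  · intro x hx
    obtain ⟨z, hz, rfl⟩ := hsurj x hx
    rw [← compress_star, D.circ_compress (hstar hz) hz, D.norm_compress (hmul (hstar hz) hz),
      D.norm_compress hz, CStarRing.norm_star_mul_self, sq]

/-- The product `x ∘ y` is the strong limit of `τⁿ(x y)` along a suitable ultrafilter. -/
theorem tendsto_iterate_mul {U : Ultrafilter ℕ} (hU : (U : Filter ℕ) ≤ atTop)
    (hpow : ∀ μ : ℂ, ‖μ‖ = 1 → Tendsto (fun n : ℕ => μ ^ n) U (𝓝 1))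
    {x y : A.toStarSubalgebra} (hx : x ∈ peripheralSpace τ) (hy : y ∈ peripheralSpace τ) (h : H) :
    Tendsto (fun n => (τ^[n] (x * y) : H →L[ℂ] H) h) U (𝓝 ((D.circ x y : H →L[ℂ] H) h)) := by
  obtain ⟨hz, hzx⟩ := D.lift_spec hx
  obtain ⟨hw, hwy⟩ := D.lift_spec hy
  set z := D.lift x
  set w := D.lift y
  have h1 := D.tendsto_iter_embed_compress hU hpow hz ((w : K →L[ℂ] K) (D.ι h))
  have h2 := D.tendsto_iter_embed_compress hU hpow hw (D.ι h)
  rw [hzx] at h1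
  rw [hwy] at h2
  -- Multiplication is jointly strongly continuous on bounded sets: replacing `θⁿ(y) h` by its limit
  -- costs at most `‖x‖` times the error.
  have h3 : Tendsto (fun n => (D.iter n (D.embed x) : K →L[ℂ] K)
      ((D.iter n (D.embed y) : K →L[ℂ] K) (D.ι h) - (w : K →L[ℂ] K) (D.ι h))) U (𝓝 0) := by
    have h4 := (tendsto_zero_iff_norm_tendsto_zero.1
      (tendsto_sub_nhds_zero_iff.2 h2)).const_mul ‖x‖
    rw [mul_zero] at h4
    refine squeeze_zero_norm (fun n => ?_) h4
    exact ContinuousLinearMap.le_of_opNorm_le _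
      ((D.norm_iter_le n _).trans (D.norm_embed_le _)) _
  have h5 := h3.add h1
  rw [zero_add] at h5
  have h6 := ((ContinuousLinearMap.adjoint D.ι.toContinuousLinearMap).continuous.tendsto _).comp h5
  refine h6.congr fun n => ?_
  have h7 : D.embed (x * y) = D.embed x * D.embed y := map_mul D.embedHom x y
  rw [← D.compress_iter_embed, h7, iter_mul_iter, compress_apply]
  simp

theorem circ_eq_circ {K' : Type*} [NormedAddCommGroup K'] [InnerProductSpace ℂ K']
    [CompleteSpace K'] (D' : MinimalDilation τ K') {x y : A.toStarSubalgebra}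
    (hx : x ∈ peripheralSpace τ) (hy : y ∈ peripheralSpace τ) : D'.circ x y = D.circ x y := by
  obtain ⟨U, hU, hpow⟩ := exists_ultrafilter_tendsto_pow_one
  ext h
  exact tendsto_nhds_unique (D'.tendsto_iterate_mul hU hpow hx hy h)
    (D.tendsto_iterate_mul hU hpow hx hy h)

end MinimalDilation

end Dilation

end PeripheralBoundary

theorem mainTheorem2
    {H : Type*} [NormedAddCommGroup H] [InnerProductSpace ℂ H] [CompleteSpace H]
    {K : Type*} [NormedAddCommGroup K] [InnerProductSpace ℂ K] [CompleteSpace K]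
    (A : VonNeumannAlgebra H)
    (τ : A.toStarSubalgebra →ₗ[ℂ] A.toStarSubalgebra)
    (hcp : PeripheralBoundary.IsCompletelyPositive τ)
    (hcontr : ∀ x, ‖τ x‖ ≤ ‖x‖)
    (hnormal : PeripheralBoundary.IsNormalMap τ)
    (D : PeripheralBoundary.MinimalDilation τ K) :
    -- peripheral eigenvectors lift uniquely, by the strong limit of `θⁿ(x) / μⁿ`
    (∀ μ : ℂ, ‖μ‖ = 1 → ∀ x ∈ PeripheralBoundary.eigenspace τ μ,
      ∃ z ∈ PeripheralBoundary.eigenspace D.endo μ,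
        D.compress z = x ∧
        (∀ w ∈ PeripheralBoundary.eigenspace D.endo μ, D.compress w = x → w = z) ∧
        ∀ k : K, Filter.Tendsto
          (fun n : ℕ => (μ ^ n)⁻¹ • (D.endo^[n] (D.embed x) : K →L[ℂ] K) k)
          Filter.atTop (nhds ((z : K →L[ℂ] K) k))) ∧
    -- the compression is a complete isometric (order) isomorphism of `P(θ)` onto `P(τ)`
    (Set.BijOn D.compress (PeripheralBoundary.peripheralSpace D.endo)
        (PeripheralBoundary.peripheralSpace τ) ∧
      ∀ (k : ℕ) (Z : Fin k → Fin k → D.B.toStarSubalgebra),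
        (∀ i j, Z i j ∈ PeripheralBoundary.peripheralSpace D.endo) →
        ‖CStarMatrix.ofMatrix (fun i j => (D.compress (Z i j) : H →L[ℂ] H))‖ =
            ‖CStarMatrix.ofMatrix (fun i j => (Z i j : K →L[ℂ] K))‖ ∧
        (0 ≤ CStarMatrix.ofMatrix (fun i j => (D.compress (Z i j) : H →L[ℂ] H)) ↔
          0 ≤ CStarMatrix.ofMatrix (fun i j => (Z i j : K →L[ℂ] K)))) ∧
    -- `P(θ)` is a `C*`-subalgebra of `B`, and transporting its product to `P(τ)` makes the latter
    -- a `C*`-algebra; the product on `P(τ)` does not depend on the minimal dilation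
    (PeripheralBoundary.IsCStarAlgebraFor (PeripheralBoundary.peripheralSpace D.endo)
        (fun z w => z * w) ∧
      (∀ x ∈ PeripheralBoundary.peripheralSpace τ,
        D.lift x ∈ PeripheralBoundary.peripheralSpace D.endo ∧ D.compress (D.lift x) = x) ∧
      (∀ z ∈ PeripheralBoundary.peripheralSpace D.endo,
        ∀ w ∈ PeripheralBoundary.peripheralSpace D.endo,
          D.circ (D.compress z) (D.compress w) = D.compress (z * w)) ∧
      PeripheralBoundary.IsCStarAlgebraFor (PeripheralBoundary.peripheralSpace τ) D.circ ∧
      ∀ (K' : Type*) [NormedAddCommGroup K'] [InnerProductSpace ℂ K'] [CompleteSpace K']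
        (D' : PeripheralBoundary.MinimalDilation τ K'),
        ∀ x ∈ PeripheralBoundary.peripheralSpace τ,
          ∀ y ∈ PeripheralBoundary.peripheralSpace τ, D'.circ x y = D.circ x y) := by
  refine ⟨fun μ hμ x hx => ?_, ⟨D.compress_bijOn, fun k Z hZ => D.compress_matrix hZ⟩,
    D.isCStarAlgebraFor_endo, fun x hx => D.lift_spec hx, fun z hz w hw => D.circ_compress hz hw,
    D.isCStarAlgebraFor_circ, fun K' _ _ _ D' x hx y hy => D.circ_eq_circ D' hx hy⟩
  obtain ⟨z, hz, hzx, hlim⟩ := D.exists_lift hμ hx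
  refine ⟨z, hz, hzx, fun w hw hwx => ?_, fun k => (hlim k).congr fun n => ?_⟩
  -- Both lifts are the strong limit of the same rescaled iterates of `x`.
  · ext k
    exact tendsto_nhds_unique (hwx ▸ D.tendsto_rescaled_compress hμ hw k) (hlim k)
  · rw [PeripheralBoundary.MinimalDilation.rescaled, D.iter_apply]
    rfl
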